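/- **Requests.** Let $T$ be a number of content types. There are $K<\infty$ recurring objects $k$, each with a type $\mathrm{typ}(k)\in[T]$ and a size $w_k>0$, and, for every type $t$, at most countably many rare objects of type $t$, all of the same size $\bar w_t>0$. Requests arrive at times $0=A(0)\le A(1)\le A(2)\le\dots$; the $l$-th request ($l\ge 1$) is for the object $c(l)$. The state $Z(l)\in\{1,\dots,K+T\}$ of the $l$-th request is $k$ if $c(l)$ is the recurring object $k$, and $K+t$ if $c(l)$ is a rare object of type $t$. Assume: * the interarrival times $X(l)=A(l)-A(l-1)$ are i.i.d. and nonnegative, with a law that has a density $f$ with respect to Lebesgue measure such that $f(x)>0$ and $f(y)>0$ imply $f(z)>0$ for all $z\in(x,y)$, and with finite nonzero mean $1/\lambda$; * $(Z(l))_{l\ge 1}$ is a Markov chain, with arbitrary initial law, whose transition matrix $P$ is irreducible with positive diagonal; its stationary distribution is $\pi$; * the sequence $(X(l))_l$ is independent of the sequence $(Z(l))_l$. Which rare object of type $t$ is requested when $Z(l)=K+t$ is arbitrary (it may depend on the arrival times), subject only to the following $R$-rarity condition. Let $\beta_t(l;R)\in\{0,1\}$ indicate that $c(l)$ is a rare object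 of type $t$ and that $A(l)-A(l')<R$ for some $l'<l$ with $c(l')=c(l)$. For every $t$ and every integer sequence $N_m=\omega(\sqrt m)$, almost surely $$\lim_{m\to\infty}\frac1{N_m}\sum_{l=m}^{m+N_m}\beta_t(l;R)=0 .$$ **Algorithms with fixed TTLs, started with empty caches.** *d-TTL* with TTL vector $\theta\in\mathbb R_+^T$: at each request for an object of type $t$ the timer of that object is set to $\theta_t$; timers run down in real time, and the request is a hit if the timer it finds is positive. *f-TTL* with TTL pair $(\theta,\theta^s)$: each object carries a tuple $(\psi^0,\psi^1,\psi^2)$ of timers (deep, shallow and shadow cache) that run down in real time to $0$. A request for an object of type $t$ is a hit if $\psi^0>0$ or $\psi^1>0$, a virtual hit if it is not a hit and $\psi^2>0$, and a miss otherwise; the tuple is then set to $(\theta_t,0,0)$ on a hit or virtual hit, and to $(0,\theta^s_t,\theta_t)$ on a miss. The object is in the cache at time $\tau$ if $\psi^0>0$ or $\psi^1>0$ at time $\tau$. **Performance.** Let $\widehat w=1$ for the object hit rate and $\widehat w=w$ for the byte hit rate. The hit rate of type $t$ is $$\liminf_{\tau\to\infty}\frac{\sum_{l:A(l)\le\tau,\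 c(l)\text{ of type }t,\ l\text{ a hit}}\widehat w_{c(l)}}{\sum_{l:A(l)\le\tau,\ c(l)\text{ of type }t}\widehat w_{c(l)}}$$ and the normalized size of type $t$ is $$\limsup_{\tau\to\infty}\frac{\int_0^\tau\sum_{c\text{ of type }t\text{ in the cache at time }u}w_c\,du}{\sum_{l:A(l)\le\tau,\ c(l)\text{ of type }t}w_{c(l)}} .$$ For $L\in\mathbb R^T$, and $\preceq$ the componentwise order, a vector $h\in\mathbb R^T$ is *$L$-feasible for d-TTL* if there is $\theta$ with $0\preceq\theta\preceq L$ such that almost surely d-TTL with fixed TTL $\theta$ has hit rate $h_t$ for every type $t$. A pair $(h,s)$ of vectors is *$L$-feasible for f-TTL* if there are $0\preceq\theta^s\preceq\theta\preceq L$ such that almost surely f-TTL with fixed $(\theta,\theta^s)$ has hit rate $h_t$ and normalized size $s_t$ for every type $t$. **The functions $h$ and $s$.** For a recurring object $k$ let $\lambda_k=\lambda\pi_k$, and let $p_k$ be the distribution function of the sum of $\nu$ independent copies of $X(1)$, where $\nu$ is independent of them and distributed as the first return time of the chain to the state $k$. Let $\hat s_k(a)=\int_0^a x\,dp_k(x)+a(1-p_k(a))$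 and $\alpha_t=\pi_{K+t}$. With sums over the recurring objects $k$ of type $t$, put $$h_t(\theta,\theta^s)=\frac{\sum_k\widehat w_k\lambda_k\left(p_k(\theta_t)^2+(1-p_k(\theta_t))\,p_k(\theta^s_t)\right)}{\widehat{\bar w}_t\,\alpha_t\lambda+\sum_k\widehat w_k\lambda_k},$$ $$s_t(\theta,\theta^s)=\frac{\sum_k w_k\lambda_k\left(p_k(\theta_t)\,\hat s_k(\theta_t)+(1-p_k(\theta_t))\,\hat s_k(\theta^s_t)\right)+\bar w_t\,\alpha_t\lambda\,\theta^s_t}{\bar w_t\,\alpha_t\lambda+\sum_k w_k\lambda_k}.$$ **Corollary.** Let the requests be as above, with the $R$-rarity condition for $R=\|L\|_\infty$. Then, for the object hit rate as well as for the byte hit rate, the set of $L$-feasible hit rates for d-TTL is $$\{h(\theta,\theta):0\preceq\theta\preceq L\},$$ and the set of $L$-feasible (hit rate, normalized size) tuples for f-TTL is $$\{(h(\theta,\theta^s),s(\theta,\theta^s)):\theta\preceq L,\ 0\preceq\theta^s\preceq\theta\}.$$ -/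

import Mathlib

open MeasureTheory ProbabilityTheory Filter Asymptotics
open scoped NNReal ENNReal Matrix Topology

noncomputable section

namespace TTLCache

/-- The universe of objects: `Sum.inl k` is the recurring object `k`, and `Sum.inr (t, n)` is the
rare object of type `t` with label `n` (there may be countably many rare objects of each type). -/
abbrev Obj (K T : ℕ) : Type := Fin K ⊕ (Fin T × ℕ)

/-- The states of the labelling chain: one state for each recurring object, and one state for each
type of rare objects. -/
abbrev State (K T : ℕ) : Type := Fin K ⊕ Fin T

/-- The state of an object: its label if it is recurring, its type if it is rare. -/
def stateOf {K T : ℕ} : Obj K T → State K T := Sum.map id Prod.fst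

/-- Types and sizes of the objects. All rare objects of one type have the same size. -/
structure Catalog (K T : ℕ) where
  /-- the type of a recurring object -/
  typ : Fin K → Fin T
  /-- the size of a recurring object -/
  size : Fin K → ℝ
  /-- the common size of the rare objects of a type -/
  rareSize : Fin T → ℝ
  size_pos : ∀ k, 0 < size k
  rareSize_pos : ∀ t, 0 < rareSize t

namespace Catalog

variable {K T : ℕ}

/-- The type of an object. -/
def objType (M : Catalog K T) : Obj K T → Fin T := Sum.elim M.typ Prod.fst

/-- The size of an object. -/
def objSize (M : Catalog K T) : Obj K T → ℝ := Sum.elim M.size (fun r => M.rareSize r.1)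

end Catalog

/-- Which hit rate is meant: the object hit rate or the byte hit rate. -/
inductive HitKind
  | object
  | byte

/-- The weight of an object in the hit rate: `1` for the object hit rate, the size for the byte hit
rate. -/
def hitWeight {K T : ℕ} (M : Catalog K T) : HitKind → Obj K T → ℝ
  | HitKind.object => fun _ => 1
  | HitKind.byte => M.objSize

/-! ### The request process

The requests are numbered `0, 1, 2, …`. Request `l` asks for the object `c l` and arrives `x l` time
units after the preceding request (after time `0` if `l = 0`). -/

/-- `arrival x n` is the arrival time of the `n`-th request when counting from one, with
`arrival x 0 = 0`; hence request `l` arrives at time `arrival x (l + 1)`. -/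
def arrival (x : ℕ → ℝ) (n : ℕ) : ℝ := ∑ i ∈ Finset.range n, x i

/-- The time between request `l` and the preceding request for the same object (`⊤` if there is
none). -/
def xPre {K T : ℕ} (x : ℕ → ℝ) (c : ℕ → Obj K T) (l : ℕ) : EReal :=
  ⨅ l' ∈ {l' : ℕ | l' < l ∧ c l' = c l}, ((arrival x (l + 1) - arrival x (l' + 1) : ℝ) : EReal)

open Classical in
/-- The bursty arrival indicator: request `l` is for a rare object of type `t` that was requested
less than `R` time units before. -/
def bursty {K T : ℕ} (x : ℕ → ℝ) (c : ℕ → Obj K T) (t : Fin T) (R : ℝ) (l : ℕ) : ℝ :=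
  if (∃ n : ℕ, c l = Sum.inr (t, n)) ∧ xPre x c l < (R : EReal) then 1 else 0

/-- The general content request model. The interarrival times `X` are i.i.d., nonnegative, with a
density whose support is an interval, and with a finite nonzero mean; the states `Z l` of the
requested objects form a Markov chain with an irreducible transition matrix `P` with positive
diagonal, and the processes `X` and `Z` are independent. The rare labels are arbitrary and may
depend on `X`. -/
structure RequestModel {K T : ℕ} {Ω : Type*} [MeasurableSpace Ω] (μ : Measure Ω)
    (P : Matrix (State K T) (State K T) ℝ) (X : ℕ → Ω → ℝ) (c : ℕ → Ω → Obj K T) : Prop where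
  measurable_X : ∀ l, Measurable (X l)
  measurable_c : ∀ l, Measurable (c l)
  indep_X : iIndepFun X μ
  indep_XZ : IndepFun (fun ω l => X l ω) (fun ω l => stateOf (c l ω)) μ
  density : ∃ f : ℝ → ℝ≥0, Measurable f ∧ (∀ x < 0, f x = 0) ∧ {x | 0 < f x}.OrdConnected ∧
    ∀ l, μ.map (X l) = volume.withDensity (fun x => (f x : ℝ≥0∞))
  integrable_X : Integrable (X 0) μ
  mean_pos : 0 < ∫ ω, X 0 ω ∂μ
  stochastic : P ∈ Matrix.rowStochastic ℝ (State K T)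
  irreducible : P.IsIrreducible
  diag_pos : ∀ s, 0 < P s s
  markov : ∀ (n : ℕ) (z : ℕ → State K T),
    μ.real {ω | ∀ l ≤ n + 1, stateOf (c l ω) = z l} =
      μ.real {ω | ∀ l ≤ n, stateOf (c l ω) = z l} * P (z n) (z (n + 1))

/-- The `R`-rarity condition: over every window of `N m = ω(√m)` requests that starts at request
`m`, the fraction of bursty arrivals of each type tends to zero almost surely. -/
def RarityCondition {K T : ℕ} {Ω : Type*} [MeasurableSpace Ω] (μ : Measure Ω)
    (X : ℕ → Ω → ℝ) (c : ℕ → Ω → Obj K T) (R : ℝ) : Prop :=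
  ∀ (t : Fin T) (N : ℕ → ℕ),
    (fun m : ℕ => Real.sqrt (m : ℝ)) =o[atTop] (fun m : ℕ => (N m : ℝ)) →
    ∀ᵐ ω ∂μ, Tendsto
      (fun m : ℕ => (1 / (N m : ℝ)) *
        ∑ l ∈ Finset.Icc m (m + N m), bursty (fun i => X i ω) (fun i => c i ω) t R l)
      atTop (𝓝 0)

/-! ### Hit rate and normalized size of a caching algorithm along a sample path -/

section Performance

variable {K T : ℕ} (M : Catalog K T) (x : ℕ → ℝ) (c : ℕ → Obj K T)

open Classical in
/-- The total weight of the requests for objects of type `t` that arrive up to time `τ` and that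
satisfy `S`. (Almost surely only finitely many requests arrive up to time `τ`.) -/
def requestWeight (w : Obj K T → ℝ) (S : ℕ → Prop) (t : Fin T) (τ : ℝ) : ℝ :=
  ∑' l : ℕ, if arrival x (l + 1) ≤ τ ∧ M.objType (c l) = t ∧ S l then w (c l) else 0

/-- The hit rate of type `t`, where `Y l` says that request `l` is a cache hit. -/
def hitRate (κ : HitKind) (Y : ℕ → Prop) (t : Fin T) : EReal :=
  liminf (fun τ : ℝ =>
    ((requestWeight M x c (hitWeight M κ) Y t τ /
      requestWeight M x c (hitWeight M κ) (fun _ => True) t τ : ℝ) : EReal)) atTop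

open Classical in
/-- The normalized size of type `t`, where `C u` is the set of objects in the cache at time `u`. -/
def normalizedSize (C : ℝ → Set (Obj K T)) (t : Fin T) : EReal :=
  limsup (fun τ : ℝ =>
    (((∫ u in (0 : ℝ)..τ, ∑' o : Obj K T,
        if o ∈ C u ∧ M.objType o = t then M.objSize o else 0) /
      requestWeight M x c M.objSize (fun _ => True) t τ : ℝ) : EReal)) atTop

end Performance

/-! ### The TTL algorithms with fixed TTL values, started with empty caches -/

section Algorithms

variable {K T : ℕ} (M : Catalog K T)

/-- d-TTL with fixed TTL vector `θ`: the remaining TTL of every object just after the first `l`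
requests have been processed. All timers run down in real time, and the timer of the requested
object is set to the TTL of its type, both on a hit and on a miss. -/
def dTimer (θ : Fin T → ℝ) (x : ℕ → ℝ) (c : ℕ → Obj K T) : ℕ → Obj K T → ℝ
  | 0 => fun _ => 0
  | l + 1 => Function.update (fun o => max (dTimer θ x c l o - x l) 0) (c l) (θ (M.objType (c l)))

/-- Request `l` is a cache hit under d-TTL: the timer has not run down to zero. -/
def dHit (θ : Fin T → ℝ) (x : ℕ → ℝ) (c : ℕ → Obj K T) (l : ℕ) : Prop :=
  0 < dTimer M θ x c l (c l) - x l

/-- The timer tuple of an object under f-TTL. -/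
structure Timers where
  /-- remaining TTL in the deep cache -/
  deep : ℝ
  /-- remaining TTL in the shallow cache -/
  shallow : ℝ
  /-- remaining TTL of the metadata in the shadow cache -/
  shadow : ℝ

/-- The timer tuple after `s` further time units without a request for the object. -/
def Timers.age (ψ : Timers) (s : ℝ) : Timers :=
  ⟨max (ψ.deep - s) 0, max (ψ.shallow - s) 0, max (ψ.shadow - s) 0⟩

/-- The object itself is in the cache: it is in the deep cache or in the shallow cache. -/
def Timers.Cached (ψ : Timers) : Prop := 0 < ψ.deep ∨ 0 < ψ.shallow

open Classical in
/-- The new timer tuple of the requested object, where `ψ` is the tuple that the request finds and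
`a`, `b` are the TTL values of the deep (and shadow) cache and of the shallow cache. -/
def Timers.request (ψ : Timers) (a b : ℝ) : Timers :=
  if ψ.Cached then ⟨a, 0, 0⟩ -- cache hit
  else if 0 < ψ.shadow then ⟨a, 0, 0⟩ -- cache virtual hit
  else ⟨0, b, a⟩ -- cache miss

/-- f-TTL with fixed TTL pair `(θ, θs)`: the timer tuple of every object just after the first `l`
requests have been processed. -/
def fTimers (θ θs : Fin T → ℝ) (x : ℕ → ℝ) (c : ℕ → Obj K T) : ℕ → Obj K T → Timers
  | 0 => fun _ => ⟨0, 0, 0⟩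
  | l + 1 => Function.update (fun o => (fTimers θ θs x c l o).age (x l)) (c l)
      (((fTimers θ θs x c l (c l)).age (x l)).request (θ (M.objType (c l))) (θs (M.objType (c l))))

/-- Request `l` is a cache hit under f-TTL. -/
def fHit (θ θs : Fin T → ℝ) (x : ℕ → ℝ) (c : ℕ → Obj K T) (l : ℕ) : Prop :=
  ((fTimers M θ θs x c l (c l)).age (x l)).Cached

/-- The set of objects in the cache at time `u` under f-TTL: `n` is the number of requests that have
arrived up to time `u`. -/
def fCache (θ θs : Fin T → ℝ) (x : ℕ → ℝ) (c : ℕ → Obj K T) (u : ℝ) : Set (Obj K T) :=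
  {o | ∃ n : ℕ, arrival x n ≤ u ∧ u < arrival x (n + 1) ∧
    ((fTimers M θ θs x c n o).age (u - arrival x n)).Cached}

end Algorithms

/-! ### Feasible targets -/

section Feasible

variable {K T : ℕ} {Ω : Type*} [MeasurableSpace Ω] (M : Catalog K T) (μ : Measure Ω)
  (X : ℕ → Ω → ℝ) (c : ℕ → Ω → Obj K T)

/-- The hit rate vector `h` is `L`-feasible for d-TTL: some fixed TTL vector `θ ≼ L` achieves it
almost surely. -/
def DFeasible (L : Fin T → ℝ) (κ : HitKind) (h : Fin T → ℝ) : Prop :=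
  ∃ θ : Fin T → ℝ, 0 ≤ θ ∧ θ ≤ L ∧ ∀ᵐ ω ∂μ, ∀ t,
    hitRate M (fun l => X l ω) (fun l => c l ω) κ
      (dHit M θ (fun l => X l ω) (fun l => c l ω)) t = (h t : EReal)

/-- The pair of a hit rate vector `h` and a normalized size vector `s` is `L`-feasible for f-TTL:
some fixed TTL pair with `θs ≼ θ ≼ L` achieves both almost surely. -/
def FFeasible (L : Fin T → ℝ) (κ : HitKind) (h s : Fin T → ℝ) : Prop :=
  ∃ θ θs : Fin T → ℝ, θ ≤ L ∧ 0 ≤ θs ∧ θs ≤ θ ∧ ∀ᵐ ω ∂μ, ∀ t,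
    hitRate M (fun l => X l ω) (fun l => c l ω) κ
      (fHit M θ θs (fun l => X l ω) (fun l => c l ω)) t = (h t : EReal) ∧
    normalizedSize M (fun l => X l ω) (fun l => c l ω)
      (fCache M θ θs (fun l => X l ω) (fun l => c l ω)) t = (s t : EReal)

end Feasible

/-! ### The functions `h(θ, θs)` and `s(θ, θs)` -/

section Chain

variable {S : Type*} [Fintype S] [DecidableEq S]

/-- `p` is a stationary probability vector of the transition matrix `P`. -/
def IsStationary (P : Matrix S S ℝ) (p : S → ℝ) : Prop := p ∈ stdSimplex ℝ S ∧ p ᵥ* P = p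

/-- The stationary distribution (it exists and is unique if `P` is irreducible). -/
def stationary (P : Matrix S S ℝ) : S → ℝ := Classical.epsilon (IsStationary P)

/-- `firstPassage P j n i` is the probability that the chain started in `i` visits `j` for the first
time, after time `0`, at time `n + 1`. -/
def firstPassage (P : Matrix S S ℝ) (j : S) : ℕ → S → ℝ
  | 0 => fun i => P i j
  | n + 1 => fun i => ∑ k, if k = j then 0 else P i k * firstPassage P j n k

end Chain

section Formulas

variable {K T : ℕ} {Ω : Type*} [MeasurableSpace Ω] (M : Catalog K T) (μ : Measure Ω)
  (P : Matrix (State K T) (State K T) ℝ) (X : ℕ → Ω → ℝ)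

/-- The overall request rate `λ`. -/
def rate : ℝ := 1 / ∫ ω, X 0 ω ∂μ

/-- The request rate `λ_k = λ π_k` of the recurring object `k`. -/
def objRate (k : Fin K) : ℝ := rate μ X * stationary P (Sum.inl k)

/-- The request rate `α_t λ` of all rare objects of type `t` together. -/
def rareRate (t : Fin T) : ℝ := stationary P (Sum.inr t) * rate μ X

/-- The law of the time between two consecutive requests for the recurring object `k`: the sum of as
many independent interarrival times as the chain takes steps to return to `k`. -/
def returnLaw (k : Fin K) : Measure ℝ :=
  Measure.sum fun n : ℕ => ENNReal.ofReal (firstPassage P (Sum.inl k) n (Sum.inl k)) •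
    μ.map (fun ω => ∑ i ∈ Finset.range (n + 1), X i ω)

/-- The distribution function `p_k` of the time between requests for the recurring object `k`. -/
def pCdf (k : Fin K) (a : ℝ) : ℝ := (returnLaw μ P X k).real (Set.Iic a)

/-- `ŝ_k(a) = ∫₀^a y dp_k(y) + a (1 - p_k(a))`. -/
def sHat (k : Fin K) (a : ℝ) : ℝ :=
  (∫ y in Set.Icc 0 a, y ∂(returnLaw μ P X k)) + a * (1 - pCdf μ P X k a)

/-- The hit rate function `h(θ, θs)`. The weight of the rare objects of type `t` is evaluated at one
of them, as they all have the same weight. -/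
def hitFun (κ : HitKind) (θ θs : Fin T → ℝ) (t : Fin T) : ℝ :=
  (∑ k : Fin K with M.typ k = t, hitWeight M κ (Sum.inl k) * objRate μ P X k *
      (pCdf μ P X k (θ t) ^ 2 + (1 - pCdf μ P X k (θ t)) * pCdf μ P X k (θs t))) /
    (hitWeight M κ (Sum.inr (t, 0)) * rareRate μ P X t +
      ∑ k : Fin K with M.typ k = t, hitWeight M κ (Sum.inl k) * objRate μ P X k)

/-- The normalized size function `s(θ, θs)`. -/
def sizeFun (θ θs : Fin T → ℝ) (t : Fin T) : ℝ :=
  ((∑ k : Fin K with M.typ k = t, M.size k * objRate μ P X k *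
      (pCdf μ P X k (θ t) * sHat μ P X k (θ t) +
        (1 - pCdf μ P X k (θ t)) * sHat μ P X k (θs t))) +
      M.rareSize t * rareRate μ P X t * θs t) /
    (M.rareSize t * rareRate μ P X t +
      ∑ k : Fin K with M.typ k = t, M.size k * objRate μ P X k)

end Formulas

end TTLCache

end

/-! Both sets are ranges of the performance map, so everything reduces to one claim: for fixed TTL
values the hit rates and normalized sizes of f-TTL are almost surely the constants `hitFun` and
`sizeFun` (`ae_fTTL_performance`). Two almost sure identities for the same quantity hold at a common
sample point, so a feasible target must equal these constants. d-TTL needs no separate analysis,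
since it has the hits of f-TTL with `θs = θ` (`dHit_iff_fHit`).

Along a path, the timers just after a request depend only on whether the gap since the preceding
request for the object was less than `θ`: if so the object is kept for `θ`, otherwise for `θs`
(`fTimers_succ_self_eq`). The next request is a hit iff its gap is less than that TTL, and until
then the object occupies the cache for the minimum of TTL and gap. Performance is thus an average
over pairs of consecutive gaps.

For a recurring object `k`, a gap following a visit to `k` has law `returnLaw` whatever the past,
which turns the two gaps into `p(θ)·p(θ) + (1 - p(θ))·p(θs)` for hits, and into the same mixture of
`ŝ(θ)` and `ŝ(θs)` for sizes. The proof uses no regeneration times. A strong law for bounded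
variables orthogonal at distance `w` is applied to windows of interarrival times, centred by their
mean, and to single steps of the chain, centred by their transition probability; first passages
follow by induction on their length (`ae_tendsto_returnsAt`). Excursions longer than `B` are
discarded by a deterministic count: visits without return within `B` steps have frequency at most
about `1 / B` (`card_no_return_le`). The same count gives recurrence, and compactness of the simplex
gives the occupation frequencies.

For rare objects, the rarity condition makes the frequency of bursty requests vanish
(`ae_tendsto_avg_bursty`). Hence their hits are negligible, and all but a negligible fraction of
their requests occupy the cache for exactly `θs`.

Finally, averages over requests become averages over time because the number of requests up to `τ`
tends to infinity and grows linearly; the cache integral up to `τ` lies between the sums of holding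
times over requests up to `τ - θ t` and up to `τ`. -/

noncomputable section

namespace TTLCache

/-! ### Cesàro averages -/

section Average

/-- The average of the first `n` terms of a sequence. -/
def avg (y : ℕ → ℝ) (n : ℕ) : ℝ := (∑ l ∈ Finset.range n, y l) / n

theorem avg_add (y y' : ℕ → ℝ) (n : ℕ) : avg (fun l => y l + y' l) n = avg y n + avg y' n := by
  simp only [avg, Finset.sum_add_distrib, add_div]

theorem avg_sub (y y' : ℕ → ℝ) (n : ℕ) : avg (fun l => y l - y' l) n = avg y n - avg y' n := by
  simp only [avg, Finset.sum_sub_distrib, sub_div]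

theorem avg_const_mul (a : ℝ) (y : ℕ → ℝ) (n : ℕ) : avg (fun l => a * y l) n = a * avg y n := by
  simp only [avg, ← Finset.mul_sum, mul_div_assoc]

theorem avg_mul_const (a : ℝ) (y : ℕ → ℝ) (n : ℕ) : avg (fun l => y l * a) n = avg y n * a := by
  simp only [mul_comm _ a, avg_const_mul]

theorem avg_sum {ι : Type*} (s : Finset ι) (y : ι → ℕ → ℝ) (n : ℕ) :
    avg (fun l => ∑ i ∈ s, y i l) n = ∑ i ∈ s, avg (y i) n := by
  simp only [avg, Finset.sum_div]
  exact Finset.sum_comm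

theorem avg_mono {y y' : ℕ → ℝ} (h : ∀ l, y l ≤ y' l) (n : ℕ) : avg y n ≤ avg y' n := by
  unfold avg
  gcongr
  exact h _

theorem abs_avg_le {y : ℕ → ℝ} {C : ℝ} (h : ∀ l, |y l| ≤ C) (n : ℕ) : |avg y n| ≤ C := by
  have hC : 0 ≤ C := (abs_nonneg _).trans (h 0)
  rw [avg, abs_div, abs_of_nonneg (Nat.cast_nonneg n : (0 : ℝ) ≤ n)]
  refine div_le_of_le_mul₀ (Nat.cast_nonneg n) hC ?_
  refine (Finset.abs_sum_le_sum_abs _ _).trans ((Finset.sum_le_sum fun i _ => h i).trans ?_)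
  simp [mul_comm]

/-- Sequences whose partial sums stay at bounded distance have the same average. -/
theorem tendsto_avg_sub_of_abs_sum_le {y y' : ℕ → ℝ} {D : ℝ}
    (h : ∀ n, |∑ l ∈ Finset.range n, y l - ∑ l ∈ Finset.range n, y' l| ≤ D) :
    Tendsto (fun n => avg y n - avg y' n) atTop (𝓝 0) := by
  refine squeeze_zero_norm (fun n => ?_) (tendsto_const_div_atTop_nhds_zero_nat D)
  rw [avg, avg, ← sub_div, Real.norm_eq_abs, abs_div,
    abs_of_nonneg (Nat.cast_nonneg n : (0 : ℝ) ≤ n)]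
  gcongr
  exact h n

theorem tendsto_avg_shift_sub {y : ℕ → ℝ} {C : ℝ} (h : ∀ l, |y l| ≤ C) :
    Tendsto (fun n => avg (fun l => y (l + 1)) n - avg y n) atTop (𝓝 0) := by
  refine tendsto_avg_sub_of_abs_sum_le (D := C + C) fun n => ?_
  have : ∑ l ∈ Finset.range n, y (l + 1) - ∑ l ∈ Finset.range n, y l = y n - y 0 := by
    rw [← Finset.sum_sub_distrib, Finset.sum_range_sub]
  rw [this]
  exact (abs_sub _ _).trans (add_le_add (h _) (h _))

end Average

/-! ### A strong law from orthogonality at a distance -/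

section StrongLaw

/-- Averages of a bounded sequence along the squares control all averages. -/
theorem tendsto_average_of_tendsto_sq {y : ℕ → ℝ} {C : ℝ} (hb : ∀ l, |y l| ≤ C)
    (h : Tendsto (fun k : ℕ => (∑ l ∈ Finset.range (k ^ 2), y l) / (k : ℝ) ^ 2) atTop (𝓝 0)) :
    Tendsto (fun n : ℕ => (∑ l ∈ Finset.range n, y l) / (n : ℝ)) atTop (𝓝 0) := by
  have hC : 0 ≤ C := (abs_nonneg _).trans (hb 0)
  have hsqrt : Tendsto Nat.sqrt atTop atTop :=
    tendsto_atTop.2 fun b => (eventually_ge_atTop (b * b)).mono fun n hn => Nat.le_sqrt.2 hn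
  have h1 := (h.comp hsqrt).abs
  have h2 : Tendsto (fun k : ℕ => C * 2 * (1 / (k : ℝ))) atTop (𝓝 0) := by
    simpa using tendsto_one_div_atTop_nhds_zero_nat.const_mul (C * 2)
  have h3 := h1.add (h2.comp hsqrt)
  simp only [abs_zero, add_zero] at h3
  refine squeeze_zero_norm' ?_ h3
  filter_upwards [eventually_ge_atTop 1] with n hn
  -- With `k² ≤ n ≤ k² + 2k`, at most `2k` terms lie beyond the square; they contribute at most `2Ck
  -- / k²`, which tends to zero.
  set k := Nat.sqrt n with hk
  have hk1 : 1 ≤ k := Nat.le_sqrt.2 (by simpa using hn)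
  have hkn : k ^ 2 ≤ n := by rw [pow_two]; exact Nat.sqrt_le n
  have hnk : n ≤ k ^ 2 + 2 * k := by
    have := Nat.sqrt_le_add n
    rw [← hk] at this
    rw [pow_two]
    omega
  have hk0 : (0 : ℝ) < k := by exact_mod_cast hk1
  have hkn' : (k : ℝ) ^ 2 ≤ n := by exact_mod_cast hkn
  have hS : |∑ l ∈ Finset.range n, y l| ≤ |∑ l ∈ Finset.range (k ^ 2), y l| + C * (2 * k) := by
    rw [← Finset.sum_range_add_sum_Ico _ hkn]
    refine (abs_add_le _ _).trans (add_le_add le_rfl ?_)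
    refine (Finset.abs_sum_le_sum_abs _ _).trans ((Finset.sum_le_sum fun i _ => hb i).trans ?_)
    rw [Finset.sum_const, nsmul_eq_mul, Nat.card_Ico, mul_comm]
    have : ((n - k ^ 2 : ℕ) : ℝ) ≤ 2 * k := by
      have : n - k ^ 2 ≤ 2 * k := by omega
      exact_mod_cast this
    gcongr
  simp only [Function.comp, Real.norm_eq_abs, abs_div, ← hk]
  rw [abs_of_nonneg (Nat.cast_nonneg n : (0 : ℝ) ≤ n), abs_of_nonneg (sq_nonneg (k : ℝ))]
  calc |∑ l ∈ Finset.range n, y l| / n ≤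
      (|∑ l ∈ Finset.range (k ^ 2), y l| + C * (2 * k)) / (k : ℝ) ^ 2 := by gcongr
    _ = _ := by field_simp

variable {Ω : Type*} [MeasurableSpace Ω] {μ : Measure Ω} [IsProbabilityMeasure μ]

/-- The second moment of a sum of bounded random variables that are orthogonal at distance `w`. -/
theorem integral_sum_sq_le_of_orthogonal {Y : ℕ → Ω → ℝ} {C : ℝ} {w : ℕ}
    (hm : ∀ l, Measurable (Y l)) (hb : ∀ l ω, |Y l ω| ≤ C)
    (ho : ∀ l l', l + w ≤ l' → ∫ ω, Y l ω * Y l' ω ∂μ = 0) (n : ℕ) :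
    ∫ ω, (∑ l ∈ Finset.range n, Y l ω) ^ 2 ∂μ ≤ n * (2 * w * C ^ 2) := by
  have hint : ∀ l l', Integrable (fun ω => Y l ω * Y l' ω) μ := fun l l' =>
    Integrable.of_bound ((hm l).mul (hm l')).aestronglyMeasurable (C * C)
      (.of_forall fun ω => by
        rw [norm_mul]
        exact mul_le_mul (hb l ω) (hb l' ω) (norm_nonneg _) ((abs_nonneg _).trans (hb l ω)))
  have hle : ∀ l l', ∫ ω, Y l ω * Y l' ω ∂μ ≤ C ^ 2 := fun l l' => by
    have : ∫ ω, Y l ω * Y l' ω ∂μ ≤ ∫ _, C ^ 2 ∂μ :=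
      integral_mono (hint l l') (integrable_const _) fun ω => by
        rw [pow_two]
        exact (le_abs_self _).trans (by
          rw [abs_mul]
          exact mul_le_mul (hb l ω) (hb l' ω) (abs_nonneg _) ((abs_nonneg _).trans (hb l ω)))
    simpa using this
  simp_rw [pow_two (∑ l ∈ Finset.range n, Y l _), Finset.sum_mul_sum]
  rw [integral_finsetSum _ fun l _ => integrable_finsetSum _ fun l' _ => hint l l']
  simp_rw [integral_finsetSum _ fun l' _ => hint _ l']
  -- In row `l` only the at most `2w` columns at distance about `w` survive, each with a moment at
  -- most `C ^ 2`.
  have hrow : ∀ l, ∑ l' ∈ Finset.range n, ∫ ω, Y l ω * Y l' ω ∂μ ≤ 2 * w * C ^ 2 := fun l => by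
    calc ∑ l' ∈ Finset.range n, ∫ ω, Y l ω * Y l' ω ∂μ
        ≤ ∑ l' ∈ Finset.range n, if l' ∈ Finset.Ico (l - w) (l + w) then C ^ 2 else 0 := by
          refine Finset.sum_le_sum fun l' _ => ?_
          split_ifs with h
          · exact hle l l'
          · rw [Finset.mem_Ico, not_and_or] at h
            rcases h with h | h
            · simp_rw [mul_comm (Y l _)]
              exact (ho l' l (by omega)).le
            · exact (ho l l' (by omega)).le
      _ ≤ ∑ l' ∈ Finset.Ico (l - w) (l + w), C ^ 2 := by
          rw [← Finset.sum_filter]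
          exact Finset.sum_le_sum_of_subset_of_nonneg
            (fun x hx => (Finset.mem_filter.1 hx).2) fun _ _ _ => sq_nonneg C
      _ ≤ 2 * w * C ^ 2 := by
          rw [Finset.sum_const, nsmul_eq_mul, Nat.card_Ico]
          have : ((l + w - (l - w) : ℕ) : ℝ) ≤ 2 * w := by
            have : l + w - (l - w) ≤ 2 * w := by omega
            exact_mod_cast this
          gcongr
  calc _ ≤ ∑ _l ∈ Finset.range n, 2 * w * C ^ 2 := Finset.sum_le_sum fun l _ => hrow l
    _ = _ := by simp

/-- A strong law of large numbers for bounded random variables that are orthogonal at distance at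
least `w`. -/
theorem ae_tendsto_average_of_orthogonal {Y : ℕ → Ω → ℝ} {C : ℝ} (w : ℕ)
    (hm : ∀ l, Measurable (Y l)) (hb : ∀ l ω, |Y l ω| ≤ C)
    (ho : ∀ l l', l + w ≤ l' → ∫ ω, Y l ω * Y l' ω ∂μ = 0) :
    ∀ᵐ ω ∂μ, Tendsto (fun n : ℕ => (∑ l ∈ Finset.range n, Y l ω) / (n : ℝ)) atTop (𝓝 0) := by
  -- Along the squares the second moments are `O(1 / k²)`, hence summable, so the series of the `V
  -- k` is almost surely finite and its terms tend to zero.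
  set V : ℕ → Ω → ℝ := fun k ω => ((∑ l ∈ Finset.range (k ^ 2), Y l ω) / (k : ℝ) ^ 2) ^ 2 with hV
  have hVm : ∀ k, Measurable (V k) := fun k =>
    ((Finset.measurable_sum _ fun l _ => hm l).div_const _).pow_const 2
  have hVi : ∀ k, Integrable (V k) μ := fun k =>
    Integrable.of_bound (hVm k).aestronglyMeasurable (((k ^ 2 : ℕ) * C / (k : ℝ) ^ 2) ^ 2)
      (.of_forall fun ω => by
        have : |∑ l ∈ Finset.range (k ^ 2), Y l ω| ≤ (k ^ 2 : ℕ) * C := by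
          refine (Finset.abs_sum_le_sum_abs _ _).trans
            ((Finset.sum_le_sum fun i _ => hb i ω).trans ?_)
          simp
        rw [hV, Real.norm_eq_abs, abs_pow, abs_div, abs_of_nonneg (sq_nonneg (k : ℝ))]
        gcongr)
  have hVle : ∀ k, ∫ ω, V k ω ∂μ ≤ 2 * w * C ^ 2 * (1 / (k : ℝ) ^ 2) := fun k => by
    simp_rw [hV, div_pow]
    rw [integral_div]
    have := integral_sum_sq_le_of_orthogonal hm hb ho (k ^ 2)
    rcases Nat.eq_zero_or_pos k with rfl | hk
    · simp
    · rw [div_le_iff₀ (by positivity)]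
      refine this.trans (le_of_eq ?_)
      push_cast
      field_simp
  have hsum : ∑' k, ∫⁻ ω, ENNReal.ofReal (V k ω) ∂μ < ∞ := by
    have : ∀ k, ∫⁻ ω, ENNReal.ofReal (V k ω) ∂μ ≤
        ENNReal.ofReal (2 * w * C ^ 2 * (1 / (k : ℝ) ^ 2)) := fun k => by
      rw [← ofReal_integral_eq_lintegral_ofReal (hVi k) (.of_forall fun ω => sq_nonneg _)]
      exact ENNReal.ofReal_le_ofReal (hVle k)
    refine (ENNReal.tsum_le_tsum this).trans_lt ?_
    have hs : Summable fun k : ℕ => 2 * w * C ^ 2 * (1 / (k : ℝ) ^ 2) :=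
      (Real.summable_one_div_nat_pow.2 one_lt_two).mul_left _
    rw [← ENNReal.ofReal_tsum_of_nonneg (fun k => by positivity) hs]
    exact ENNReal.ofReal_lt_top
  rw [← lintegral_tsum fun k => (hVm k).ennreal_ofReal.aemeasurable] at hsum
  filter_upwards [ae_lt_top (Measurable.tsum fun k => (hVm k).ennreal_ofReal) hsum.ne]
    with ω hω
  refine tendsto_average_of_tendsto_sq (fun l => hb l ω) ?_
  have h0 := ENNReal.tendsto_atTop_zero_of_tsum_ne_top hω.ne
  have h1 : Tendsto (fun k => V k ω) atTop (𝓝 0) := by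
    have := (ENNReal.tendsto_toReal ENNReal.zero_ne_top).comp h0
    refine this.congr fun k => ?_
    simp [hV, ENNReal.toReal_ofReal (sq_nonneg _)]
  have h2 := (Real.continuous_sqrt.tendsto 0).comp h1
  rw [Real.sqrt_zero] at h2
  refine squeeze_zero_norm (fun k => ?_) h2
  simp [hV, Real.sqrt_sq_eq_abs, abs_div]

end StrongLaw

/-! ### Invariant vectors of irreducible matrices -/

section Stationary

variable {S : Type*} [Fintype S] [DecidableEq S] {P : Matrix S S ℝ}

theorem vecMul_pow_eq_self {r : S → ℝ} (hr : r ᵥ* P = r) (n : ℕ) : r ᵥ* P ^ n = r := by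
  induction n with
  | zero => simp
  | succ n ih => rw [pow_succ, ← Matrix.vecMul_vecMul, ih, hr]

/-- A nonnegative invariant vector of an irreducible matrix is zero or positive. -/
theorem pos_of_vecMul_eq_self (hP : P.IsIrreducible) {r : S → ℝ} (h0 : 0 ≤ r)
    (hr : r ᵥ* P = r) {i : S} (hi : 0 < r i) (j : S) : 0 < r j := by
  obtain ⟨n, -, hn⟩ := (Matrix.isIrreducible_iff_exists_pow_pos hP.nonneg).1 hP i j
  rw [← vecMul_pow_eq_self hr n, Matrix.vecMul, dotProduct]
  refine lt_of_lt_of_le (mul_pos hi hn) (Finset.single_le_sum (f := fun a => r a * (P ^ n) a j)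
    (fun a _ => mul_nonneg (h0 a) (Matrix.pow_apply_nonneg hP.nonneg n a j)) (Finset.mem_univ i))

theorem IsStationary.pos (hP : P.IsIrreducible) {p : S → ℝ} (hp : IsStationary P p) (j : S) :
    0 < p j := by
  obtain ⟨i, hi⟩ : ∃ i, 0 < p i := by
    by_contra! h
    have := hp.1.2
    linarith [Finset.sum_nonpos fun i (_ : i ∈ Finset.univ) => h i]
  exact pos_of_vecMul_eq_self hP hp.1.1 hp.2 hi j

/-- The stationary distribution of an irreducible matrix is unique. -/
theorem IsStationary.eq (hP : P.IsIrreducible) {p q : S → ℝ} (hp : IsStationary P p)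
    (hq : IsStationary P q) : p = q := by
  have hS : Nonempty S := by
    by_contra h
    have := hp.1.2
    rw [not_nonempty_iff] at h
    simp at this
  -- At the minimizer of `p / q`, the nonnegative invariant vector `p - (p a / q a) • q` vanishes,
  -- so by the dichotomy it vanishes everywhere.
  obtain ⟨a, ha⟩ := Finite.exists_min fun i => p i / q i
  have h0 : 0 ≤ p - (p a / q a) • q := fun i => by
    have := (le_div_iff₀ (hq.pos hP i)).1 (ha i)
    simpa using this
  have hr : (p - (p a / q a) • q) ᵥ* P = p - (p a / q a) • q := by
    rw [Matrix.sub_vecMul, Matrix.smul_vecMul, hp.2, hq.2]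
  have hz : p - (p a / q a) • q = 0 := by
    by_contra hne
    obtain ⟨i, hi⟩ : ∃ i, (p - (p a / q a) • q) i ≠ 0 := by
      by_contra! h
      exact hne (funext h)
    have := pos_of_vecMul_eq_self hP h0 hr (lt_of_le_of_ne (h0 i) hi.symm) a
    simp [(hq.pos hP a).ne'] at this
  have hpq : p = (p a / q a) • q := sub_eq_zero.1 hz
  have h1 : p a / q a = 1 := by
    have := hp.1.2
    rw [hpq] at this
    simp_rw [Pi.smul_apply, smul_eq_mul, ← Finset.mul_sum] at this
    rwa [hq.1.2, mul_one] at this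
  rw [hpq, h1, one_smul]

end Stationary

/-! ### Freezing an independent variable -/

section Independence

variable {Ω : Type*} [MeasurableSpace Ω] {μ : Measure Ω} [IsProbabilityMeasure μ]

/-- If `f` and `g` are independent and `F (f, b)` has mean zero for every `b`, then so has
`F (f, g)`. -/
theorem integral_comp_prod_eq_zero_of_indepFun {α β : Type*} [MeasurableSpace α]
    [MeasurableSpace β] {f : Ω → α} {g : Ω → β} (hf : Measurable f) (hg : Measurable g)
    (hfg : IndepFun f g μ) {F : α × β → ℝ} (hF : Measurable F)
    (h0 : ∀ b, ∫ ω, F (f ω, b) ∂μ = 0) :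
    ∫ ω, F (f ω, g ω) ∂μ = 0 := by
  have := Measure.isProbabilityMeasure_map (μ := μ) hf.aemeasurable
  have := Measure.isProbabilityMeasure_map (μ := μ) hg.aemeasurable
  have h1 : ∫ ω, F (f ω, g ω) ∂μ = ∫ p, F p ∂((μ.map f).prod (μ.map g)) := by
    rw [← (indepFun_iff_map_prod_eq_prod_map_map hf.aemeasurable hg.aemeasurable).1 hfg,
      integral_map (hf.prodMk hg).aemeasurable hF.aestronglyMeasurable]
  rw [h1]
  -- Without integrability the claim still holds, as the integral is then zero by convention.
  by_cases hint : Integrable F ((μ.map f).prod (μ.map g))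
  · rw [integral_prod_symm _ hint]
    refine integral_eq_zero_of_ae (.of_forall fun b => ?_)
    exact (integral_map (f := fun a => F (a, b)) hf.aemeasurable
      (hF.comp (measurable_id.prodMk measurable_const)).aestronglyMeasurable).trans (h0 b)
  · exact integral_undef hint

end Independence

/-! ### Independence of windows and the Markov property -/

section Input

variable {S Ω : Type*} [MeasurableSpace S]

/-- The σ-algebra generated by `X i` for `i ∈ I` and `Z j` for `j ∈ J`. -/
@[reducible] def hist (X : ℕ → Ω → ℝ) (Z : ℕ → Ω → S) (I J : Set ℕ) : MeasurableSpace Ω :=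
  MeasurableSpace.comap (fun ω => ((fun i : I => X i ω), (fun j : J => Z j ω))) inferInstance

variable {X : ℕ → Ω → ℝ} {Z : ℕ → Ω → S} {I J I' J' : Set ℕ}

theorem measurable_hist_X {i : ℕ} (hi : i ∈ I) : Measurable[hist X Z I J] (X i) := by
  have h : Measurable fun p : (I → ℝ) × (J → S) => p.1 ⟨i, hi⟩ := by fun_prop
  exact h.comp (comap_measurable _)

theorem measurable_hist_Z {j : ℕ} (hj : j ∈ J) : Measurable[hist X Z I J] (Z j) := by
  have h : Measurable fun p : (I → ℝ) × (J → S) => p.2 ⟨j, hj⟩ := by fun_prop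
  exact h.comp (comap_measurable _)

theorem hist_mono (hI : I ⊆ I') (hJ : J ⊆ J') : hist X Z I J ≤ hist X Z I' J' := by
  let := hist X Z I' J'
  exact Measurable.comap_le ((measurable_pi_iff.2 fun i => measurable_hist_X (hI i.2)).prodMk
    (measurable_pi_iff.2 fun j => measurable_hist_Z (hJ j.2)))

/-- An i.i.d. sequence `X` and an independent Markov chain `Z` with transition matrix `P`. -/
structure MarkovInput [Fintype S] [DecidableEq S] [MeasurableSpace Ω] (μ : Measure Ω) (P : Matrix S S ℝ) (X : ℕ → Ω → ℝ) (Z : ℕ → Ω → S) :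
    Prop where
  measurable_X : ∀ l, Measurable (X l)
  measurable_Z : ∀ l, Measurable (Z l)
  indep_X : iIndepFun X μ
  indep_XZ : IndepFun (fun ω l => X l ω) (fun ω l => Z l ω) μ
  map_X : ∀ l, μ.map (X l) = μ.map (X 0)
  stochastic : P ∈ Matrix.rowStochastic ℝ S
  markov : ∀ (n : ℕ) (z : ℕ → S),
    μ.real {ω | ∀ l ≤ n + 1, Z l ω = z l} = μ.real {ω | ∀ l ≤ n, Z l ω = z l} * P (z n) (z (n + 1))

variable [Fintype S] [DecidableEq S] [MeasurableSpace Ω]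
  {μ : Measure Ω} {P : Matrix S S ℝ}

theorem MarkovInput.hist_le (h : MarkovInput μ P X Z) (I J : Set ℕ) :
    hist X Z I J ≤ ‹MeasurableSpace Ω› :=
  Measurable.comap_le (Measurable.prodMk (measurable_pi_iff.2 fun i => h.measurable_X i)
    (measurable_pi_iff.2 fun j => h.measurable_Z j))

/-- The time from request `l` to request `l + m + 1`. -/
def window (x : ℕ → ℝ) (l m : ℕ) : ℝ := ∑ i ∈ Finset.range (m + 1), x (l + 1 + i)

theorem MarkovInput.map_sum (h : MarkovInput μ P X Z) (l m : ℕ) :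
    μ.map (fun ω => ∑ i ∈ Finset.range m, X (l + i) ω) =
      μ.map (fun ω => ∑ i ∈ Finset.range m, X i ω) := by
  have hident : ∀ i, IdentDistrib (X (l + i)) (X i) μ μ := fun i =>
    ⟨(h.measurable_X _).aemeasurable, (h.measurable_X _).aemeasurable, by
      rw [h.map_X (l + i), h.map_X i]⟩
  have h1 := IdentDistrib.pi (μ := μ) (ν := μ) hident (h.indep_X.precomp (add_right_injective l))
    h.indep_X
  exact (h1.comp (u := fun x : ℕ → ℝ => ∑ i ∈ Finset.range m, x i) (by fun_prop)).map_eq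

theorem MarkovInput.integral_window (h : MarkovInput μ P X Z) {v : ℝ → ℝ} (hv : Measurable v)
    (l m : ℕ) :
    ∫ ω, v (window (fun i => X i ω) l m) ∂μ =
      ∫ ω, v (∑ i ∈ Finset.range (m + 1), X i ω) ∂μ := by
  have hX := h.measurable_X
  rw [← integral_map (φ := fun ω => window (fun i => X i ω) l m) (f := v)
    (by unfold window; fun_prop) hv.aestronglyMeasurable,
    ← integral_map (φ := fun ω => ∑ i ∈ Finset.range (m + 1), X i ω) (f := v)
    (by fun_prop) hv.aestronglyMeasurable]
  unfold window
  rw [h.map_sum (l + 1) (m + 1)]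

variable [IsProbabilityMeasure μ]

/-- A window of interarrival times is independent of the preceding ones and of the chain. -/
theorem MarkovInput.integral_mul_window_sub (h : MarkovInput μ P X Z) {l m : ℕ} {H : Ω → ℝ}
    (hH : Measurable[hist X Z (Set.Iic l) Set.univ] H) {v : ℝ → ℝ} (hv : Measurable v) {C : ℝ}
    (hvb : ∀ x, |v x| ≤ C) :
    ∫ ω, H ω * (v (window (fun i => X i ω) l m) -
      ∫ ω', v (∑ i ∈ Finset.range (m + 1), X i ω') ∂μ) ∂μ = 0 := by
  obtain ⟨g, hg, rfl⟩ := hH.exists_eq_measurable_comp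
  have hX := h.measurable_X
  have hZ := h.measurable_Z
  set e := ∫ ω', v (∑ i ∈ Finset.range (m + 1), X i ω') ∂μ with he
  -- With the whole path of the chain frozen, `H` depends on the interarrival times up to `l` and
  -- the window on those in `(l, l + m + 1]`, so the product factorizes.
  refine integral_comp_prod_eq_zero_of_indepFun (f := fun ω l => X l ω) (g := fun ω l => Z l ω)
    (F := fun p => g ((fun i => p.1 i), (fun j => p.2 j)) * (v (window p.1 l m) - e))
    (by fun_prop) (by fun_prop) h.indep_XZ ?_ fun z => ?_
  · unfold window
    fun_prop
  · have hdisj : Disjoint (Finset.Iic l) (Finset.Ioc l (l + m + 1)) := by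
      rw [Finset.disjoint_left]
      intro a ha hb
      simp only [Finset.mem_Iic, Finset.mem_Ioc] at ha hb
      omega
    have hind := h.indep_X.indepFun_finset _ _ hdisj hX
    have hind2 := hind.comp
      (φ := fun x : Finset.Iic l → ℝ => g ((fun i : Set.Iic l => x ⟨i, Finset.mem_Iic.2 i.2⟩),
        fun j => z j))
      (ψ := fun x : Finset.Ioc l (l + m + 1) → ℝ => v (∑ i : Fin (m + 1), x ⟨l + 1 + i, by
        simp only [Finset.mem_Ioc]; omega⟩) - e) (by fun_prop) (by fun_prop)
    have hψ : ∀ ω, ((fun x : Finset.Ioc l (l + m + 1) → ℝ => v (∑ i : Fin (m + 1), x ⟨l + 1 + i, by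
        simp only [Finset.mem_Ioc]; omega⟩) - e) ∘ fun a (i : Finset.Ioc l (l + m + 1)) => X i a) ω =
        v (window (fun i => X i ω) l m) - e := fun ω => by
      simp only [Function.comp, window]
      rw [Fin.sum_univ_eq_sum_range (fun i => X (l + 1 + i) ω)]
    have hmul := hind2.integral_mul_eq_mul_integral
      (by apply Measurable.aestronglyMeasurable; fun_prop)
      (by apply Measurable.aestronglyMeasurable; fun_prop)
    rw [show ((fun x : Finset.Ioc l (l + m + 1) → ℝ => v (∑ i : Fin (m + 1), x ⟨l + 1 + i, by
        simp only [Finset.mem_Ioc]; omega⟩) - e) ∘ fun a (i : Finset.Ioc l (l + m + 1)) => X i a) =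
        fun ω => v (window (fun i => X i ω) l m) - e from funext hψ] at hmul
    refine Eq.trans ?_ (hmul.trans ?_)
    · rfl
    · have hvi : Integrable (fun ω => v (window (fun i => X i ω) l m)) μ :=
        Integrable.of_bound (by unfold window; apply Measurable.aestronglyMeasurable; fun_prop) C
          (.of_forall fun ω => hvb _)
      rw [integral_sub hvi (integrable_const _), h.integral_window hv]
      simp [he]

variable [DiscreteMeasurableSpace S]

/-- The Markov property, given the whole sequence of interarrival times. -/
theorem MarkovInput.integral_mul_indicator_sub (h : MarkovInput μ P X Z) {l : ℕ} {H : Ω → ℝ}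
    (hH : Measurable[hist X Z Set.univ (Set.Iic l)] H) (j : S) :
    ∫ ω, H ω * ((if Z (l + 1) ω = j then 1 else 0) - P (Z l ω) j) ∂μ = 0 := by
  obtain ⟨g, hg, rfl⟩ := hH.exists_eq_measurable_comp
  have hX := h.measurable_X
  have hZ := h.measurable_Z
  have hφ : Measurable fun p : S × S => (if p.2 = j then (1 : ℝ) else 0) - P p.1 j :=
    measurable_of_countable _
  refine integral_comp_prod_eq_zero_of_indepFun (f := fun ω l => Z l ω) (g := fun ω l => X l ω)
    (F := fun p => g ((fun i => p.2 i), (fun j => p.1 j)) *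
      (fun p : S × S => (if p.2 = j then (1 : ℝ) else 0) - P p.1 j) (p.1 l, p.1 (l + 1)))
    (by fun_prop) (by fun_prop) h.indep_XZ.symm ?_ fun x => ?_
  · exact (hg.comp (by fun_prop)).mul (hφ.comp (by fun_prop))
  -- With the interarrival times frozen, `H` is a finite combination of indicators of histories `ζ`
  -- of the chain up to `l`; on each history the claim is the hypothesis `markov`.
  · have hsum : ∀ ω, g ((fun i => x i), (fun i : Set.Iic l => Z i ω)) *
        ((if Z (l + 1) ω = j then (1 : ℝ) else 0) - P (Z l ω) j) =
        ∑ ζ : Set.Iic l → S, g ((fun i => x i), ζ) *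
          ((if (fun i : Set.Iic l => Z i ω) = ζ ∧ Z (l + 1) ω = j then (1 : ℝ) else 0) -
            (if (fun i : Set.Iic l => Z i ω) = ζ then (1 : ℝ) else 0) *
              P (ζ ⟨l, Set.mem_Iic.2 le_rfl⟩) j) := fun ω => by
      rw [Finset.sum_eq_single (fun i : Set.Iic l => Z i ω)]
      · simp
      · intro ζ _ hζ
        simp [hζ.symm]
      · simp
    simp only
    simp_rw [hsum]
    have hset1 : ∀ ζ : Set.Iic l → S, MeasurableSet {ω | (fun i : Set.Iic l => Z i ω) = ζ} :=
      fun ζ => (measurable_pi_iff.2 fun i : Set.Iic l => hZ i) (MeasurableSet.singleton ζ)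
    have hset2 : ∀ ζ : Set.Iic l → S,
        MeasurableSet {ω | (fun i : Set.Iic l => Z i ω) = ζ ∧ Z (l + 1) ω = j} :=
      fun ζ => (hset1 ζ).inter ((hZ (l + 1)) (MeasurableSet.singleton j))
    have hi1 : ∀ ζ : Set.Iic l → S, Integrable (fun ω =>
        if (fun i : Set.Iic l => Z i ω) = ζ then (1 : ℝ) else 0) μ := fun ζ =>
      Integrable.of_bound ((measurable_const.ite (hset1 ζ) measurable_const).aestronglyMeasurable) 1
        (.of_forall fun ω => by split_ifs <;> simp)
    have hi2 : ∀ ζ : Set.Iic l → S, Integrable (fun ω =>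
        if (fun i : Set.Iic l => Z i ω) = ζ ∧ Z (l + 1) ω = j then (1 : ℝ) else 0) μ := fun ζ =>
      Integrable.of_bound ((measurable_const.ite (hset2 ζ) measurable_const).aestronglyMeasurable) 1
        (.of_forall fun ω => by split_ifs <;> simp)
    refine (integral_finsetSum _ fun ζ _ =>
      ((hi2 ζ).sub ((hi1 ζ).mul_const _)).const_mul _).trans ?_
    refine Finset.sum_eq_zero fun ζ _ => ?_
    rw [integral_const_mul]
    refine mul_eq_zero_of_right _ ((integral_sub (hi2 ζ) ((hi1 ζ).mul_const _)).trans ?_)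
    rw [integral_mul_const]
    have e1 : ∫ ω, (if (fun i : Set.Iic l => Z i ω) = ζ then (1 : ℝ) else 0) ∂μ =
        μ.real {ω | (fun i : Set.Iic l => Z i ω) = ζ} := by
      rw [← integral_indicator_one (hset1 ζ)]
      exact integral_congr_ae (.of_forall fun ω => by simp [Set.indicator])
    have e2 : ∫ ω, (if (fun i : Set.Iic l => Z i ω) = ζ ∧ Z (l + 1) ω = j then (1 : ℝ) else 0) ∂μ =
        μ.real {ω | (fun i : Set.Iic l => Z i ω) = ζ ∧ Z (l + 1) ω = j} := by
      rw [← integral_indicator_one (hset2 ζ)]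
      exact integral_congr_ae (.of_forall fun ω => by simp [Set.indicator])
    -- The history is continued by the constant `j`, so that the path prescribes the value `j` at
    -- time `l + 1`.
    have hm := h.markov l (fun i => if hi : i ≤ l then ζ ⟨i, hi⟩ else j)
    have s1 : {ω | ∀ i ≤ l, Z i ω = if hi : i ≤ l then ζ ⟨i, hi⟩ else j} =
        {ω | (fun i : Set.Iic l => Z i ω) = ζ} := by
      ext ω
      simp only [Set.mem_ofPred_eq, funext_iff]
      exact ⟨fun hω i => by simpa [i.2.out] using hω i i.2, fun hω i hi => by
        simpa [hi] using hω ⟨i, hi⟩⟩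
    have s2 : {ω | ∀ i ≤ l + 1, Z i ω = if hi : i ≤ l then ζ ⟨i, hi⟩ else j} =
        {ω | (fun i : Set.Iic l => Z i ω) = ζ ∧ Z (l + 1) ω = j} := by
      ext ω
      simp only [Set.mem_ofPred_eq, funext_iff]
      refine ⟨fun hω => ⟨fun i => ?_, by simpa using hω (l + 1) le_rfl⟩, fun hω i hi => ?_⟩
      · have hi : (i : ℕ) ≤ l := i.2
        simpa [hi] using hω i (by omega)
      · rcases Nat.le_succ_iff.1 hi with hi | rfl
        · simpa [hi] using hω.1 ⟨i, hi⟩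
        · simpa using hω.2
    rw [e1, e2, ← s1, ← s2, hm]
    simp

end Input

/-! ### First returns along a path -/

section ReturnTimes

variable {S : Type*}

/-- The path `z` is at `k` at time `l + m + 1`, but not at the times `l + 1, …, l + m`. -/
def ReturnsAt (z : ℕ → S) (k : S) (m l : ℕ) : Prop :=
  (∀ i < m, z (l + 1 + i) ≠ k) ∧ z (l + 1 + m) = k

instance [DecidableEq S] (z : ℕ → S) (k : S) (m l : ℕ) : Decidable (ReturnsAt z k m l) :=
  inferInstanceAs (Decidable (_ ∧ _))

theorem returnsAt_zero {z : ℕ → S} {k : S} {l : ℕ} : ReturnsAt z k 0 l ↔ z (l + 1) = k := by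
  simp [ReturnsAt]

theorem returnsAt_succ {z : ℕ → S} {k : S} {m l : ℕ} :
    ReturnsAt z k (m + 1) l ↔ z (l + 1) ≠ k ∧ ReturnsAt z k m (l + 1) := by
  simp only [ReturnsAt, Nat.forall_lt_succ_left, add_zero, and_assoc,
    show l + 1 + (m + 1) = l + 1 + 1 + m by omega]
  refine and_congr_right fun _ => and_congr_left fun _ => forall₂_congr fun i _ => ?_
  rw [show l + 1 + (i + 1) = l + 1 + 1 + i by omega]

theorem ReturnsAt.eq {z : ℕ → S} {k : S} {m m' l : ℕ} (h : ReturnsAt z k m l)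
    (h' : ReturnsAt z k m' l) : m = m' := by
  rcases lt_trichotomy m m' with hlt | rfl | hlt
  · exact absurd h.2 (h'.1 m hlt)
  · rfl
  · exact absurd h'.2 (h.1 m' hlt)

end ReturnTimes

/-! ### Strong laws for the chain and the interarrival times -/

section InputAverages

variable {S Ω : Type*} [Fintype S] [DecidableEq S] [MeasurableSpace S] [MeasurableSpace Ω]
  {X : ℕ → Ω → ℝ} {Z : ℕ → Ω → S} {μ : Measure Ω} {P : Matrix S S ℝ}
  [IsProbabilityMeasure μ]

/-- The strong law for the windows of interarrival times. -/
theorem MarkovInput.ae_tendsto_window (h : MarkovInput μ P X Z) {a : ℕ → Ω → ℝ} {C : ℝ}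
    (ha : ∀ l, Measurable[hist X Z (Set.Iic l) Set.univ] (a l)) (hb : ∀ l ω, |a l ω| ≤ C)
    {v : ℝ → ℝ} (hv : Measurable v) {D : ℝ} (hvb : ∀ x, |v x| ≤ D) (m : ℕ) :
    ∀ᵐ ω ∂μ, Tendsto (avg fun l => a l ω * (v (window (fun i => X i ω) l m) -
      ∫ ω', v (∑ i ∈ Finset.range (m + 1), X i ω') ∂μ)) atTop (𝓝 0) := by
  set e := ∫ ω', v (∑ i ∈ Finset.range (m + 1), X i ω') ∂μ with he
  have heD : |e| ≤ D := by
    have := norm_integral_le_of_norm_le_const (μ := μ)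
      (f := fun ω' => v (∑ i ∈ Finset.range (m + 1), X i ω')) (.of_forall fun ω => hvb _)
    simpa using this
  have hY : ∀ l l', l + (m + 1) ≤ l' → Measurable[hist X Z (Set.Iic l') Set.univ] fun ω =>
      a l ω * (v (window (fun i => X i ω) l m) - e) := fun l l' hl => by
    have hw : Measurable[hist X Z (Set.Iic l') Set.univ] fun ω => window (fun i => X i ω) l m :=
      Finset.measurable_sum _ fun i hi => measurable_hist_X (Set.mem_Iic.2 (by
        rw [Finset.mem_range] at hi
        omega))
    exact ((ha l).mono (hist_mono (Set.Iic_subset_Iic.2 (by omega)) subset_rfl) le_rfl).mul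
      ((hv.comp hw).sub_const e)
  -- At distance `m + 1` the earlier window is part of the past of the later one. The weights may
  -- use the whole chain, including its future; this is what later allows the excursion length to be
  -- placed in the weight.
  refine ae_tendsto_average_of_orthogonal (C := C * (D + D)) (m + 1) (fun l => ?_)
    (fun l ω => ?_) fun l l' hl => ?_
  · exact (hY l _ le_rfl).mono (h.hist_le _ _) le_rfl
  · rw [abs_mul]
    exact mul_le_mul (hb l ω) ((abs_sub _ _).trans (add_le_add (hvb _) heD)) (abs_nonneg _)
      ((abs_nonneg _).trans (hb l ω))
  · simp_rw [← mul_assoc]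
    exact h.integral_mul_window_sub ((hY l l' hl).mul (ha l')) hv hvb

variable [DiscreteMeasurableSpace S]

/-- The strong law for one step of the chain. -/
theorem MarkovInput.ae_tendsto_step (h : MarkovInput μ P X Z) {a : ℕ → Ω → ℝ} {C : ℝ}
    (ha : ∀ l, Measurable[hist X Z Set.univ (Set.Iic l)] (a l)) (hb : ∀ l ω, |a l ω| ≤ C) (j : S) :
    ∀ᵐ ω ∂μ, Tendsto (avg fun l => a l ω * ((if Z (l + 1) ω = j then 1 else 0) - P (Z l ω) j))
      atTop (𝓝 0) := by
  have hξ : ∀ l l', l + 1 ≤ l' → Measurable[hist X Z Set.univ (Set.Iic l')] fun ω =>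
      (if Z (l + 1) ω = j then (1 : ℝ) else 0) - P (Z l ω) j := fun l l' hl => by
    have h1 : Measurable[hist X Z Set.univ (Set.Iic l')] (Z (l + 1)) :=
      measurable_hist_Z (Set.mem_Iic.2 hl)
    have h2 : Measurable[hist X Z Set.univ (Set.Iic l')] (Z l) :=
      measurable_hist_Z (Set.mem_Iic.2 (by omega))
    exact ((Measurable.of_discrete (f := fun s : S => if s = j then (1 : ℝ) else 0)).comp h1).sub
      ((Measurable.of_discrete (f := fun s : S => P s j)).comp h2)
  have hY : ∀ l l', l + 1 ≤ l' → Measurable[hist X Z Set.univ (Set.Iic l')] fun ω =>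
      a l ω * ((if Z (l + 1) ω = j then (1 : ℝ) else 0) - P (Z l ω) j) := fun l l' hl =>
    ((ha l).mono (hist_mono subset_rfl (Set.Iic_subset_Iic.2 (by omega))) le_rfl).mul (hξ l l' hl)
  refine ae_tendsto_average_of_orthogonal (C := C) 1 (fun l => ?_) (fun l ω => ?_) fun l l' hl => ?_
  · exact (hY l (l + 1) le_rfl).mono (h.hist_le _ _) le_rfl
  · rw [abs_mul]
    have h0 := Matrix.nonneg_of_mem_rowStochastic h.stochastic (i := Z l ω) (j := j)
    have h1 := Matrix.le_one_of_mem_rowStochastic h.stochastic (i := Z l ω) (j := j)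
    refine (mul_le_of_le_one_right (abs_nonneg _) ?_).trans (hb l ω)
    rw [abs_le]
    split_ifs <;> constructor <;> linarith
  · simp_rw [← mul_assoc]
    exact h.integral_mul_indicator_sub
      ((hY l l' hl).mul (ha l')) j

/-- The strong law for the first passage of the chain to `k`. -/
theorem MarkovInput.ae_tendsto_firstPassage (h : MarkovInput μ P X Z) (k : S) (m : ℕ) :
    ∀ {a : ℕ → Ω → ℝ} {C : ℝ} (_ : ∀ l, Measurable[hist X Z Set.univ (Set.Iic l)] (a l))
    (_ : ∀ l ω, |a l ω| ≤ C),
    ∀ᵐ ω ∂μ, Tendsto (avg fun l => a l ω *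
      ((if ReturnsAt (fun i => Z i ω) k m l then 1 else 0) - firstPassage P k m (Z l ω)))
      atTop (𝓝 0) := by
  induction m with
  | zero =>
    intro a C ha hb
    simpa only [returnsAt_zero, firstPassage] using h.ae_tendsto_step ha hb k
  | succ m ih =>
    intro a C ha hb
    have hC : 0 ≤ C := by
      obtain ⟨ω⟩ : Nonempty Ω := μ.nonempty_of_neZero
      exact (abs_nonneg _).trans (hb 0 ω)
    -- A passage of length `m + 2` from `l` is a step avoiding `k` followed by one of length `m + 1`
    -- from `l + 1`. The avoidance is absorbed into the weight at `l + 1`, which is why the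
    -- induction is over all weights; the value at `0` is irrelevant to the average.
    set b : ℕ → Ω → ℝ := fun l ω =>
      match l with
      | 0 => 0
      | l + 1 => a l ω * (if Z (l + 1) ω = k then 0 else 1) with hbdef
    have hbm : ∀ l, Measurable[hist X Z Set.univ (Set.Iic l)] (b l) := by
      rintro (_ | l)
      · exact measurable_const
      · have h1 : Measurable[hist X Z Set.univ (Set.Iic (l + 1))] (Z (l + 1)) :=
          measurable_hist_Z (Set.mem_Iic.2 le_rfl)
        exact ((ha l).mono (hist_mono subset_rfl (Set.Iic_subset_Iic.2 (by omega))) le_rfl).mul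
          ((Measurable.of_discrete (f := fun s : S => if s = k then (0 : ℝ) else 1)).comp h1)
    have hbb : ∀ l ω, |b l ω| ≤ C := by
      rintro (_ | l) ω
      · simpa [hbdef] using hC
      · simp only [hbdef]
        split_ifs
        · simpa using hC
        · simpa using hb l ω
    obtain ⟨D, hD⟩ : ∃ D, ∀ s, |firstPassage P k m s| ≤ D := by
      obtain ⟨D, hD⟩ := (Set.finite_range fun s => |firstPassage P k m s|).bddAbove
      exact ⟨D, fun s => hD ⟨s, rfl⟩⟩
    -- After the induction hypothesis what remains is the passage probability from the state at `l +
    -- 1`; the one-step law replaces it by its conditional mean given the state at `l`.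
    have hsteps := ae_all_iff.2 fun j => h.ae_tendsto_step
      (a := fun l ω => a l ω * (if j = k then 0 else firstPassage P k m j)) (C := C * D)
      (fun l => (ha l).mul_const _) (fun l ω => by
        rw [abs_mul]
        refine mul_le_mul (hb l ω) ?_ (abs_nonneg _) hC
        split_ifs
        · simpa using (abs_nonneg _).trans (hD k)
        · exact hD j) j
    filter_upwards [ih hbm hbb, hsteps] with ω h1 h2
    have h3 := tendsto_avg_shift_sub (y := fun l => b l ω *
      ((if ReturnsAt (fun i => Z i ω) k m l then 1 else 0) - firstPassage P k m (Z l ω)))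
      (C := C * (1 + D)) fun l => by
        rw [abs_mul]
        refine mul_le_mul (hbb l ω) ((abs_sub _ _).trans (add_le_add ?_ (hD _))) (abs_nonneg _) hC
        split_ifs <;> simp
    have h4 := (h3.add h1).add (tendsto_finsetSum Finset.univ fun j _ => h2 j)
    simp only [sub_add_cancel, Finset.sum_const_zero, add_zero] at h4
    refine h4.congr fun n => ?_
    rw [← avg_sum, ← avg_add]
    congr 1
    funext l
    simp only [hbdef, returnsAt_succ, firstPassage]
    have e1 : ∑ j, a l ω * (if j = k then 0 else firstPassage P k m j) *
        ((if Z (l + 1) ω = j then 1 else 0) - P (Z l ω) j) =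
        a l ω * ((if Z (l + 1) ω = k then 0 else firstPassage P k m (Z (l + 1) ω)) -
          ∑ j, if j = k then 0 else P (Z l ω) j * firstPassage P k m j) := by
      simp only [mul_sub, Finset.sum_sub_distrib, mul_ite, mul_one,
        mul_zero, Finset.sum_ite_eq, Finset.mem_univ, if_true, Finset.mul_sum]
      congr 1
      refine Finset.sum_congr rfl fun j _ => ?_
      split_ifs <;> ring
    rw [e1]
    by_cases hk : Z (l + 1) ω = k
    · simp [hk]
    · simp only [hk, if_false, ne_eq, not_false_eq_true, true_and]
      ring

/-- The strong law for the time to the next visit to `k`, on visits to `k` that are followed by an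
excursion of a given length. -/
theorem MarkovInput.ae_tendsto_returnsAt (h : MarkovInput μ P X Z) {a : ℕ → Ω → ℝ} {C : ℝ}
    (ha : ∀ l, Measurable[hist X Z (Set.Iic l) (Set.Iic l)] (a l)) (hb : ∀ l ω, |a l ω| ≤ C)
    {v : ℝ → ℝ} (hv : Measurable v) {D : ℝ} (hvb : ∀ x, |v x| ≤ D) (k : S) (m : ℕ) :
    ∀ᵐ ω ∂μ, Tendsto (fun n =>
      avg (fun l => if Z l ω = k ∧ ReturnsAt (fun i => Z i ω) k m l then
        a l ω * v (window (fun i => X i ω) l m) else 0) n -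
      firstPassage P k m k * (∫ ω', v (∑ i ∈ Finset.range (m + 1), X i ω') ∂μ) *
        avg (fun l => if Z l ω = k then a l ω else 0) n) atTop (𝓝 0) := by
  have hC : 0 ≤ C := by
    obtain ⟨ω⟩ : Nonempty Ω := μ.nonempty_of_neZero
    exact (abs_nonneg _).trans (hb 0 ω)
  have hk : ∀ {I J : Set ℕ} {l : ℕ}, l ∈ J → MeasurableSet[hist X Z I J] {ω | Z l ω = k} :=
    fun {I J l} hl => (measurable_hist_Z hl : Measurable[hist X Z I J] (Z l))
      (MeasurableSet.singleton k)
  have h1 := h.ae_tendsto_firstPassage k m (C := C)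
    (a := fun l ω => if Z l ω = k then a l ω else 0)
    (fun l => Measurable.ite (hk (Set.mem_Iic.2 le_rfl))
      ((ha l).mono (hist_mono (Set.subset_univ _) subset_rfl) le_rfl) measurable_const)
    (fun l ω => by split_ifs <;> simp [hb, hC])
  have h2 := h.ae_tendsto_window (C := C)
    (a := fun l ω => if Z l ω = k ∧ ReturnsAt (fun i => Z i ω) k m l then a l ω else 0)
    (fun l => Measurable.ite ((hk (Set.mem_univ _)).inter (by
        have : {ω | ReturnsAt (fun i => Z i ω) k m l} =
            (⋂ i ∈ Finset.range m, {ω | Z (l + 1 + i) ω = k}ᶜ) ∩ {ω | Z (l + 1 + m) ω = k} := by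
          ext ω
          simp [ReturnsAt]
        change MeasurableSet[hist X Z _ _] {ω | ReturnsAt (fun i => Z i ω) k m l}
        rw [this]
        refine MeasurableSet.inter ?_ (hk (Set.mem_univ _))
        exact Finset.measurableSet_biInter _ fun i _ => (hk (Set.mem_univ _)).compl))
      ((ha l).mono (hist_mono subset_rfl (Set.subset_univ _)) le_rfl) measurable_const)
    (fun l ω => by split_ifs <;> simp [hb, hC]) hv hvb m
  filter_upwards [h1, h2] with ω h1 h2
  -- First the window is replaced by its mean, with the excursion length in the weight; then the
  -- excursion indicator is replaced by the first passage probability.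
  have h3 := h2.add (h1.const_mul (∫ ω', v (∑ i ∈ Finset.range (m + 1), X i ω') ∂μ))
  simp only [mul_zero, add_zero] at h3
  refine h3.congr fun n => ?_
  rw [← avg_const_mul, ← avg_const_mul, ← avg_add, ← avg_sub]
  congr 1
  funext l
  by_cases hz : Z l ω = k
  · by_cases hr : ReturnsAt (fun i => Z i ω) k m l
    · simp only [hz, hr, and_self, if_true]
      ring
    · simp only [hz, hr, and_false, if_true, if_false]
      ring
  · simp [hz]

/-- The occupation frequencies converge to the stationary distribution, which exists. -/
theorem MarkovInput.ae_tendsto_occupation (h : MarkovInput μ P X Z) (hP : P.IsIrreducible) :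
    IsStationary P (stationary P) ∧ ∀ᵐ ω ∂μ, ∀ j,
      Tendsto (avg fun l => if Z l ω = j then 1 else 0) atTop (𝓝 (stationary P j)) := by
  have hstep := ae_all_iff.2 fun j => h.ae_tendsto_step (a := fun _ _ => 1) (C := 1)
    (fun l => measurable_const) (fun l ω => by simp) j
  -- The one-step law with weight `1`, together with the invariance of averages under a shift, makes
  -- every cluster point of the empirical frequencies invariant. Compactness of the simplex then
  -- gives existence, and uniqueness gives convergence.
  have hcl : ∀ᵐ ω ∂μ, ∀ p ∈ stdSimplex ℝ S,
      MapClusterPt p atTop (fun n j => avg (fun l => if Z l ω = j then (1 : ℝ) else 0) n) →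
      IsStationary P p := by
    filter_upwards [hstep] with ω hω p hp hc
    refine ⟨hp, ?_⟩
    have hlim : Tendsto (fun n => (fun j => avg (fun l => if Z l ω = j then (1 : ℝ) else 0) n) ᵥ* P -
        fun j => avg (fun l => if Z l ω = j then (1 : ℝ) else 0) n) atTop (𝓝 0) := by
      rw [tendsto_pi_nhds]
      intro j
      have h1 := (tendsto_avg_shift_sub (y := fun l => if Z l ω = j then (1 : ℝ) else 0) (C := 1)
        fun l => by split_ifs <;> simp).sub (hω j)
      simp only [sub_zero, one_mul] at h1
      refine h1.congr fun n => ?_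
      have : ∀ l, P (Z l ω) j = ∑ i, (if Z l ω = i then (1 : ℝ) else 0) * P i j := fun l => by simp
      simp only [Pi.sub_apply, Matrix.vecMul, dotProduct, avg_sub, this, avg_sum, avg_mul_const]
      ring
    have hcont : Continuous fun q : S → ℝ => q ᵥ* P - q := by
      refine Continuous.sub ?_ continuous_id
      exact continuous_pi fun j => continuous_finsetSum _ fun i _ =>
        (continuous_apply i).mul continuous_const
    obtain ⟨φ, hφ, hφp⟩ := hc.tendsto_subseq
    exact sub_eq_zero.1 (tendsto_nhds_unique ((hcont.tendsto p).comp hφp)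
      (hlim.comp hφ.tendsto_atTop))
  have hmem : ∀ ω, ∀ᶠ n in atTop,
      (fun j => avg (fun l => if Z l ω = j then (1 : ℝ) else 0) n) ∈ stdSimplex ℝ S := fun ω => by
    filter_upwards [eventually_ge_atTop 1] with n hn
    refine ⟨fun j => ?_, ?_⟩
    · unfold avg
      positivity
    · have : (n : ℝ) ≠ 0 := by positivity
      rw [← avg_sum]
      simp [avg, this]
  have hst : IsStationary P (stationary P) := by
    obtain ⟨ω, hω⟩ := hcl.exists
    obtain ⟨p, hp, hpc⟩ := (isCompact_stdSimplex ℝ S).exists_mapClusterPt_of_frequently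
      (hmem ω).frequently
    exact Classical.epsilon_spec ⟨p, hω p hp hpc⟩
  refine ⟨hst, ?_⟩
  filter_upwards [hcl] with ω hω
  exact tendsto_pi_nhds.1 ((isCompact_stdSimplex ℝ S).tendsto_nhds_of_unique_mapClusterPt (hmem ω)
    fun p hp hpc => (hω p hp hpc).eq hP hst)

end InputAverages

/-! ### Discarding long excursions, pathwise -/

section Returns

variable {S : Type*} [DecidableEq S]

/-- Visits to `k` without a return within `B` steps are rare. -/
theorem card_no_return_le (z : ℕ → S) (k : S) (B n : ℕ) :
    ((Finset.range n).filter fun l => z l = k ∧ ∀ m < B, ¬ ReturnsAt z k m l).card * B ≤ n + B := by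
  -- The blocks `[l, l + B)` attached to such visits are disjoint and lie in `[0, n + B)`, that is,
  -- `(l, j) ↦ l + j` is injective there.
  rw [← Finset.card_range B, ← Finset.card_product, Finset.card_range, ← Finset.card_range (n + B)]
  refine Finset.card_le_card_of_injOn (fun p => p.1 + p.2) ?_ ?_
  · rintro ⟨l, j⟩ hp
    simp only [Finset.coe_product, Set.mem_prod, Finset.mem_coe, Finset.mem_filter,
      Finset.mem_range] at hp ⊢
    omega
  · have key : ∀ l j l' j' : ℕ, z l' = k → (∀ m < B, ¬ ReturnsAt z k m l) → j < B →
        l + j = l' + j' → ¬ l < l' := fun l j l' j' hl' hno hj he hlt => by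
      have hex : ∃ i, z (l + 1 + i) = k :=
        ⟨l' - (l + 1), by rwa [show l + 1 + (l' - (l + 1)) = l' by omega]⟩
      classical
      refine hno (Nat.find hex) ?_ ⟨fun i hi => Nat.find_min hex hi, Nat.find_spec hex⟩
      have : Nat.find hex ≤ l' - (l + 1) := Nat.find_min' hex (by
        rwa [show l + 1 + (l' - (l + 1)) = l' by omega])
      omega
    rintro ⟨l, j⟩ hp ⟨l', j'⟩ hp' he
    simp only [Finset.coe_product, Set.mem_prod, Finset.mem_coe, Finset.mem_filter,
      Finset.mem_range] at hp hp' he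
    have h1 := key l j l' j' hp'.1.2.1 hp.1.2.2 hp.2 he
    have h2 := key l' j' l j hp.1.2.1 hp'.1.2.2 hp'.2 he.symm
    obtain rfl : l = l' := by omega
    simpa using he

/-- A visit whose return takes at most `B` steps is matched by exactly one summand, so the error
comes only from the visits counted in `card_no_return_le`. The bound is uniform along the path,
which allows `n → ∞` before `B → ∞`. -/
theorem abs_avg_sub_sum_returns_le {z : ℕ → S} {k : S} {q : ℕ → ℝ} {y : ℕ → ℕ → ℝ} {C : ℝ}
    (hq : ∀ l, |q l| ≤ C) (h0 : ∀ l, z l ≠ k → q l = 0)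
    (h1 : ∀ l m, z l = k → ReturnsAt z k m l → q l = y m l) {B : ℕ} (hB : 0 < B) (n : ℕ) :
    |avg q n - ∑ m ∈ Finset.range B,
      avg (fun l => if z l = k ∧ ReturnsAt z k m l then y m l else 0) n| ≤
      C * (1 / (B : ℝ) + 1 / n) := by
  have hC : 0 ≤ C := (abs_nonneg _).trans (hq 0)
  rw [← avg_sum, ← avg_sub, avg, abs_div, abs_of_nonneg (Nat.cast_nonneg n : (0 : ℝ) ≤ n)]
  have hterm : ∀ l, |q l - ∑ m ∈ Finset.range B,
      (if z l = k ∧ ReturnsAt z k m l then y m l else 0)| ≤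
      C * if z l = k ∧ ∀ m < B, ¬ ReturnsAt z k m l then 1 else 0 := fun l => by
    by_cases hz : z l = k
    · by_cases hr : ∃ m < B, ReturnsAt z k m l
      · obtain ⟨m, hm, hr⟩ := hr
        rw [Finset.sum_eq_single m, if_pos ⟨hz, hr⟩, h1 l m hz hr, sub_self, abs_zero]
        · positivity
        · exact fun m' _ hne => if_neg fun h => hne (h.2.eq hr)
        · exact fun h => absurd (Finset.mem_range.2 hm) h
      · push Not at hr
        rw [Finset.sum_eq_zero fun m hm => if_neg fun h => hr m (Finset.mem_range.1 hm) h.2,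
          if_pos ⟨hz, hr⟩, sub_zero, mul_one]
        exact hq l
    · simp [hz, h0 l hz]
  have hsum := (Finset.abs_sum_le_sum_abs _ _).trans
    (Finset.sum_le_sum fun l (_ : l ∈ Finset.range n) => hterm l)
  rw [← Finset.mul_sum, Finset.sum_boole] at hsum
  have hcard : ((((Finset.range n).filter fun l => z l = k ∧
      ∀ m < B, ¬ ReturnsAt z k m l).card : ℕ) : ℝ) * B ≤ n + B := by
    exact_mod_cast card_no_return_le z k B n
  have hB' : (0 : ℝ) < B := by exact_mod_cast hB
  rcases Nat.eq_zero_or_pos n with rfl | hn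
  · simp; positivity
  have hn' : (0 : ℝ) < n := by exact_mod_cast hn
  refine (div_le_div_of_nonneg_right hsum hn'.le).trans ?_
  rw [mul_div_assoc]
  refine mul_le_mul_of_nonneg_left ?_ hC
  rw [div_le_iff₀ hn', ← mul_le_mul_iff_left₀ hB']
  refine hcard.trans (le_of_eq ?_)
  field_simp

/-- Passage from excursions of bounded length to all excursions. -/
theorem tendsto_avg_of_returns {z : ℕ → S} {k : S} {q α : ℕ → ℝ} {y : ℕ → ℕ → ℝ} {C : ℝ}
    (hq : ∀ l, |q l| ≤ C) (h0 : ∀ l, z l ≠ k → q l = 0)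
    (h1 : ∀ l m, z l = k → ReturnsAt z k m l → q l = y m l) {A : ℝ} (hα : ∀ l, |α l| ≤ A)
    {g : ℕ → ℝ} {I : ℝ} (hg : HasSum g I)
    (hy : ∀ m, Tendsto (fun n => avg (fun l => if z l = k ∧ ReturnsAt z k m l then y m l else 0) n -
      g m * avg α n) atTop (𝓝 0)) :
    Tendsto (fun n => avg q n - I * avg α n) atTop (𝓝 0) := by
  have hC : 0 ≤ C := (abs_nonneg _).trans (hq 0)
  rw [Metric.tendsto_nhds]
  intro ε hε
  have hB1 : Tendsto (fun B : ℕ => C * (1 / (B : ℝ)) +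
      |∑ m ∈ Finset.range B, g m - I| * A) atTop (𝓝 0) := by
    have e1 := tendsto_one_div_atTop_nhds_zero_nat (𝕜 := ℝ) |>.const_mul C
    have e2 := ((hg.tendsto_sum_nat.sub_const I).abs).mul_const A
    simpa using e1.add e2
  -- The cutoff `B` controls both the missing excursions and the tail of the series `g`; only then
  -- is `n` taken large for the finitely many lengths below `B`.
  obtain ⟨B, hBε, hB0⟩ := ((hB1.eventually (gt_mem_nhds (half_pos hε))).and
    (eventually_gt_atTop 0)).exists
  have hn1 : Tendsto (fun n : ℕ => C * (1 / (n : ℝ)) + |∑ m ∈ Finset.range B,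
      (avg (fun l => if z l = k ∧ ReturnsAt z k m l then y m l else 0) n - g m * avg α n)|)
      atTop (𝓝 0) := by
    have e1 := tendsto_one_div_atTop_nhds_zero_nat (𝕜 := ℝ) |>.const_mul C
    have e2 := (tendsto_finsetSum (Finset.range B) fun m _ => hy m).abs
    simpa using e1.add e2
  filter_upwards [hn1.eventually (gt_mem_nhds (half_pos hε))] with n hn
  rw [Real.dist_eq, sub_zero]
  have hb := abs_avg_sub_sum_returns_le hq h0 h1 hB0 n
  have hαn := abs_avg_le hα n
  rw [Finset.sum_sub_distrib, ← Finset.sum_mul] at hn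
  set Y := ∑ m ∈ Finset.range B,
      avg (fun l => if z l = k ∧ ReturnsAt z k m l then y m l else 0) n
  set G := ∑ m ∈ Finset.range B, g m
  have hsplit : avg q n - I * avg α n = (avg q n - Y) + (Y - G * avg α n) + (G - I) * avg α n := by
    ring
  rw [hsplit]
  have t1 := abs_add_le (avg q n - Y + (Y - G * avg α n)) ((G - I) * avg α n)
  have t2 := abs_add_le (avg q n - Y) (Y - G * avg α n)
  have t3 : |(G - I) * avg α n| ≤ |G - I| * A := by
    rw [abs_mul]
    gcongr
  linarith

end Returns

/-! ### The return law and the strong law for gaps -/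

section ReturnMeasure

variable {S Ω : Type*} [Fintype S] [DecidableEq S] [MeasurableSpace Ω]

/-- The law of the time between two consecutive visits to the state `k`. -/
def returnMeasure (μ : Measure Ω) (P : Matrix S S ℝ) (X : ℕ → Ω → ℝ) (k : S) : Measure ℝ :=
  Measure.sum fun n : ℕ => ENNReal.ofReal (firstPassage P k n k) •
    μ.map (fun ω => ∑ i ∈ Finset.range (n + 1), X i ω)

variable {X : ℕ → Ω → ℝ} {Z : ℕ → Ω → S} {μ : Measure Ω} {P : Matrix S S ℝ}

theorem firstPassage_nonneg {P : Matrix S S ℝ} (hP : P ∈ Matrix.rowStochastic ℝ S) (k : S) (m : ℕ) (i : S) :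
    0 ≤ firstPassage P k m i := by
  induction m generalizing i with
  | zero => exact Matrix.nonneg_of_mem_rowStochastic hP
  | succ m ih =>
    refine Finset.sum_nonneg fun j _ => ?_
    split_ifs
    · exact le_rfl
    · exact mul_nonneg (Matrix.nonneg_of_mem_rowStochastic hP) (ih j)

variable [IsProbabilityMeasure μ] [MeasurableSpace S] [DiscreteMeasurableSpace S]

/-- The chain is recurrent. -/
theorem MarkovInput.hasSum_firstPassage (h : MarkovInput μ P X Z) (hP : P.IsIrreducible) (k : S) :
    HasSum (fun m => firstPassage P k m k) 1 := by
  obtain ⟨hst, hocc⟩ := h.ae_tendsto_occupation hP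
  have hy := ae_all_iff.2 fun m => h.ae_tendsto_returnsAt (a := fun _ _ => 1) (C := 1)
    (fun _ => measurable_const) (fun _ _ => by simp) (v := fun _ => 1) measurable_const (D := 1)
    (fun _ => by simp) k m
  obtain ⟨ω, hω, hyω⟩ := (hocc.and hy).exists
  have hpos := hst.pos hP k
  rw [hasSum_iff_tendsto_nat_of_nonneg (fun m => firstPassage_nonneg h.stochastic k m k)]
  -- All visits have frequency `π_k`, and those returning within `B` steps have `π_k` times the
  -- partial sum. The two differ by at most `1 / B`, and positivity of `π_k` forces the sum to be
  -- `1`.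
  have hlim : ∀ B : ℕ, 0 < B → |stationary P k - (∑ m ∈ Finset.range B, firstPassage P k m k) *
      stationary P k| ≤ 1 / (B : ℝ) := fun B hB => by
    have e1 : ∀ m, Tendsto (avg (fun l => if Z l ω = k ∧ ReturnsAt (fun i => Z i ω) k m l
        then (1 : ℝ) else 0)) atTop (𝓝 (firstPassage P k m k * stationary P k)) := fun m => by
      have := (hyω m).add ((hω k).const_mul (firstPassage P k m k))
      simpa using this
    have e2 := ((hω k).sub (tendsto_finsetSum (Finset.range B) fun m _ => e1 m)).abs
    rw [← Finset.sum_mul] at e2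
    have e3 : Tendsto (fun n : ℕ => (1 : ℝ) * (1 / (B : ℝ) + 1 / n)) atTop (𝓝 (1 / (B : ℝ))) := by
      simpa using (tendsto_one_div_atTop_nhds_zero_nat (𝕜 := ℝ)).const_add (1 / (B : ℝ))
    refine le_of_tendsto_of_tendsto' e2 e3 fun n => ?_
    exact abs_avg_sub_sum_returns_le (z := fun i => Z i ω) (k := k) (y := fun _ _ => 1)
      (fun l => by split_ifs <;> simp) (fun l hl => if_neg hl)
      (fun l m hl _ => if_pos hl) hB n
  have h2 : Tendsto (fun B : ℕ => stationary P k - (∑ m ∈ Finset.range B, firstPassage P k m k) *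
      stationary P k) atTop (𝓝 0) :=
    squeeze_zero_norm' ((eventually_gt_atTop 0).mono fun B hB => hlim B hB)
      tendsto_one_div_atTop_nhds_zero_nat
  have h3 := ((h2.const_sub (stationary P k)).div_const (stationary P k))
  simp only [sub_zero, sub_sub_cancel, div_self hpos.ne'] at h3
  exact h3.congr fun B => mul_div_cancel_right₀ _ hpos.ne'

theorem MarkovInput.isProbabilityMeasure_returnMeasure (h : MarkovInput μ P X Z)
    (hP : P.IsIrreducible) (k : S) : IsProbabilityMeasure (returnMeasure μ P X k) := by
  have hX := h.measurable_X
  have hsum := h.hasSum_firstPassage hP k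
  constructor
  rw [returnMeasure, Measure.sum_apply _ MeasurableSet.univ]
  have : ∀ n : ℕ, (ENNReal.ofReal (firstPassage P k n k) •
      μ.map (fun ω => ∑ i ∈ Finset.range (n + 1), X i ω)) Set.univ =
      ENNReal.ofReal (firstPassage P k n k) := fun n => by
    have : IsProbabilityMeasure (μ.map (fun ω => ∑ i ∈ Finset.range (n + 1), X i ω)) :=
      Measure.isProbabilityMeasure_map (by fun_prop)
    simp
  simp_rw [this]
  rw [← ENNReal.ofReal_tsum_of_nonneg (fun m => firstPassage_nonneg h.stochastic k m k)
    hsum.summable, hsum.tsum_eq, ENNReal.ofReal_one]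

theorem MarkovInput.hasSum_integral_returnMeasure (h : MarkovInput μ P X Z) (hP : P.IsIrreducible)
    (k : S) {v : ℝ → ℝ} (hv : Measurable v) {D : ℝ} (hvb : ∀ x, |v x| ≤ D) :
    HasSum (fun m => firstPassage P k m k * ∫ ω, v (∑ i ∈ Finset.range (m + 1), X i ω) ∂μ)
      (∫ x, v x ∂(returnMeasure μ P X k)) := by
  have hX := h.measurable_X
  have := h.isProbabilityMeasure_returnMeasure hP k
  have hint : Integrable v (returnMeasure μ P X k) :=
    Integrable.of_bound hv.aestronglyMeasurable D (.of_forall hvb)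
  refine (hasSum_integral_measure hint).congr_fun ?_
  intro m
  rw [integral_smul_measure, integral_map (by fun_prop) hv.aestronglyMeasurable,
    ENNReal.toReal_ofReal (firstPassage_nonneg h.stochastic k m k), smul_eq_mul]

/-- The strong law for the times between visits to `k`: if `q l = a l * v x` whenever `l` is a visit
to `k` and `x` the time until the next one, where `a l` depends on the past, then `q` averages as
`a` on the visits to `k` times the mean of `v` under the return law. -/
theorem MarkovInput.ae_tendsto_next (h : MarkovInput μ P X Z) (hP : P.IsIrreducible)
    {a : ℕ → Ω → ℝ} {C : ℝ}
    (ha : ∀ l, Measurable[hist X Z (Set.Iic l) (Set.Iic l)] (a l)) (hb : ∀ l ω, |a l ω| ≤ C)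
    {v : ℝ → ℝ} (hv : Measurable v) {D : ℝ} (hvb : ∀ x, |v x| ≤ D) (k : S) :
    ∀ᵐ ω ∂μ, ∀ (q : ℕ → ℝ) (C' : ℝ), (∀ l, |q l| ≤ C') → (∀ l, Z l ω ≠ k → q l = 0) →
      (∀ l m, Z l ω = k → ReturnsAt (fun i => Z i ω) k m l →
        q l = a l ω * v (window (fun i => X i ω) l m)) →
      Tendsto (fun n => avg q n - (∫ x, v x ∂(returnMeasure μ P X k)) *
        avg (fun l => if Z l ω = k then a l ω else 0) n) atTop (𝓝 0) := by
  -- The exceptional null set comes only from the countably many lengths `m`, so `q` may be chosen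
  -- afterwards, path by path, and may look into the future.
  filter_upwards [ae_all_iff.2 fun m => h.ae_tendsto_returnsAt ha hb hv hvb k m]
    with ω hω q C' hq h0 h1
  refine tendsto_avg_of_returns hq h0 h1 (A := C) (fun l => ?_)
    (h.hasSum_integral_returnMeasure hP k hv hvb) hω
  split_ifs
  · exact hb l ω
  · simpa using (abs_nonneg _).trans (hb l ω)

end ReturnMeasure

/-! ### Consequences of the request model -/

section Model

instance {α β : Type*} [MeasurableSpace α] [MeasurableSpace β] [DiscreteMeasurableSpace α]
    [DiscreteMeasurableSpace β] : DiscreteMeasurableSpace (α ⊕ β) :=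
  ⟨fun _ => measurableSet_sum_iff.2 ⟨.of_discrete, .of_discrete⟩⟩

variable {K T : ℕ} {Ω : Type*} [MeasurableSpace Ω] {μ : Measure Ω}
  {P : Matrix (State K T) (State K T) ℝ} {X : ℕ → Ω → ℝ} {c : ℕ → Ω → Obj K T}

theorem RequestModel.markovInput (h : RequestModel μ P X c) :
    MarkovInput μ P X (fun l ω => stateOf (c l ω)) where
  measurable_X := h.measurable_X
  measurable_Z := fun l => (Measurable.of_discrete (f := stateOf)).comp (h.measurable_c l)
  indep_X := h.indep_X
  indep_XZ := h.indep_XZ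
  map_X := fun l => by
    obtain ⟨f, -, -, -, hf⟩ := h.density
    rw [hf l, hf 0]
  stochastic := h.stochastic
  markov := h.markov

theorem RequestModel.ae_nonneg (h : RequestModel μ P X c) : ∀ᵐ ω ∂μ, ∀ l, 0 ≤ X l ω := by
  obtain ⟨f, hfm, hf0, -, hf⟩ := h.density
  refine ae_all_iff.2 fun l => ?_
  have : μ.map (X l) (Set.Iio 0) = 0 := by
    rw [hf l, withDensity_apply _ measurableSet_Iio, setLIntegral_eq_zero_iff measurableSet_Iio
      hfm.coe_nnreal_ennreal]
    exact .of_forall fun x hx => by simp [hf0 x hx]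
  rw [Measure.map_apply (h.measurable_X l) measurableSet_Iio] at this
  rw [ae_iff]
  convert this using 2
  ext ω
  simp

theorem RequestModel.noAtoms_map (h : RequestModel μ P X c) (l : ℕ) : NullSingletonClass (μ.map (X l)) := by
  obtain ⟨f, -, -, -, hf⟩ := h.density
  rw [hf l]
  exact ⟨fun x => withDensity_absolutelyContinuous _ _ (measure_singleton x)⟩

theorem RequestModel.ae_tendsto_arrival [IsProbabilityMeasure μ] (h : RequestModel μ P X c) :
    ∀ᵐ ω ∂μ, Tendsto (fun n : ℕ => arrival (fun i => X i ω) n / n) atTop (𝓝 (∫ ω, X 0 ω ∂μ)) :=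
  strong_law_ae_real X h.integrable_X (fun _ _ hij => h.indep_X.indepFun hij) fun i =>
    ⟨(h.measurable_X i).aemeasurable, (h.measurable_X 0).aemeasurable, h.markovInput.map_X i⟩

variable [IsProbabilityMeasure μ]

/-- The last summand is independent of the others and has a law without atoms, and convolution
preserves this. It is needed because a timer equal to zero is not a hit, whereas `pCdf` includes its
endpoint. -/
theorem RequestModel.sum_noAtoms (h : RequestModel μ P X c) (n : ℕ) (a : ℝ) :
    μ.map (fun ω => ∑ i ∈ Finset.range (n + 1), X i ω) {a} = 0 := by
  have hX := h.measurable_X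
  have hind : IndepFun (fun ω => ∑ i ∈ Finset.range n, X i ω) (X n) μ := by
    have := h.indep_X.indepFun_finsetSum_of_notMem hX (s := Finset.range n) (i := n) (by simp)
    convert this using 1
    ext ω
    simp
  have hm : Measurable fun ω => ∑ i ∈ Finset.range n, X i ω := by fun_prop
  have := Measure.isProbabilityMeasure_map (μ := μ) (hX n).aemeasurable
  have := Measure.isProbabilityMeasure_map (μ := μ) hm.aemeasurable
  have hset : MeasurableSet {p : ℝ × ℝ | p.1 + p.2 = a} :=
    (measurable_fst.add measurable_snd) (MeasurableSet.singleton a)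
  have h1 : μ.map (fun ω => ∑ i ∈ Finset.range (n + 1), X i ω) {a} =
      ((μ.map fun ω => ∑ i ∈ Finset.range n, X i ω).prod (μ.map (X n)))
        {p : ℝ × ℝ | p.1 + p.2 = a} := by
    rw [← (indepFun_iff_map_prod_eq_prod_map_map hm.aemeasurable (hX n).aemeasurable).1 hind,
      Measure.map_apply (hm.prodMk (hX n)) hset,
      Measure.map_apply (by fun_prop) (MeasurableSet.singleton a)]
    congr 1
    ext ω
    simp [Finset.sum_range_succ]
  rw [h1, Measure.prod_apply hset]
  have := h.noAtoms_map n
  refine (lintegral_congr fun x => ?_).trans lintegral_zero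
  have : Prod.mk x ⁻¹' {p : ℝ × ℝ | p.1 + p.2 = a} = {a - x} := by
    ext y
    simp only [Set.mem_preimage, Set.mem_ofPred_eq, Set.mem_singleton_iff]
    constructor <;> intro h <;> linarith
  rw [this, measure_singleton]

theorem RequestModel.returnLaw_singleton (h : RequestModel μ P X c) (k : Fin K) (a : ℝ) :
    returnLaw μ P X k {a} = 0 := by
  rw [returnLaw, Measure.sum_apply _ (MeasurableSet.singleton a)]
  simp [h.sum_noAtoms]

theorem RequestModel.isProbabilityMeasure_returnLaw (h : RequestModel μ P X c) (k : Fin K) :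
    IsProbabilityMeasure (returnLaw μ P X k) :=
  -- By definition, `returnLaw` is `returnMeasure` at the state `Sum.inl k`.
  h.markovInput.isProbabilityMeasure_returnMeasure h.irreducible (Sum.inl k)

theorem RequestModel.integral_lt (h : RequestModel μ P X c) (k : Fin K) (a : ℝ) :
    ∫ x, (if x < a then 1 else 0) ∂(returnLaw μ P X k) = pCdf μ P X k a := by
  have := h.isProbabilityMeasure_returnLaw k
  have hIio : (returnLaw μ P X k).real (Set.Iio a) = (returnLaw μ P X k).real (Set.Iic a) := by
    refine measureReal_congr ?_
    exact Iio_ae_eq_Iic' (h.returnLaw_singleton k a)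
  rw [pCdf, ← hIio, ← integral_indicator_one measurableSet_Iio]
  exact integral_congr_ae (.of_forall fun x => by simp [Set.indicator])

/-- `ŝ_k(a)` is the mean of the gap truncated at `a`. The maximum with zero keeps the integrand
bounded on the whole line, as the strong law demands, and matches the integration over `[0, a]` in
`sHat`. -/
theorem RequestModel.integral_min (h : RequestModel μ P X c) (k : Fin K) {a : ℝ} (ha : 0 ≤ a) :
    ∫ x, max (min a x) 0 ∂(returnLaw μ P X k) = sHat μ P X k a := by
  have := h.isProbabilityMeasure_returnLaw k
  have hfun : ∀ x : ℝ, max (min a x) 0 =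
      (Set.Icc 0 a).indicator (fun y => y) x + (Set.Ioi a).indicator (fun _ => a) x := fun x => by
    rcases lt_or_ge x 0 with hx | hx
    · have h1 : x ∉ Set.Icc 0 a := fun h => absurd h.1 (not_le.2 hx)
      have h2 : x ∉ Set.Ioi a := fun h => absurd h (not_lt.2 (hx.le.trans ha))
      rw [Set.indicator_of_notMem h1, Set.indicator_of_notMem h2, max_eq_right, add_zero]
      exact (min_le_right _ _).trans hx.le
    · rcases le_or_gt x a with hxa | hxa
      · rw [Set.indicator_of_mem (Set.mem_Icc.2 ⟨hx, hxa⟩),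
          Set.indicator_of_notMem (by simpa using hxa), min_eq_right hxa, max_eq_left hx, add_zero]
      · rw [Set.indicator_of_notMem (fun h => absurd h.2 (not_le.2 hxa)),
          Set.indicator_of_mem (Set.mem_Ioi.2 hxa), min_eq_left hxa.le, max_eq_left ha, zero_add]
  simp_rw [hfun]
  have hi1 : Integrable ((Set.Icc 0 a).indicator fun y : ℝ => y) (returnLaw μ P X k) :=
    Integrable.of_bound ((measurable_id.indicator measurableSet_Icc).aestronglyMeasurable) a
      (.of_forall fun x => by
        by_cases hx : x ∈ Set.Icc 0 a
        · rw [Set.indicator_of_mem hx, Real.norm_eq_abs, abs_of_nonneg hx.1]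
          exact hx.2
        · rw [Set.indicator_of_notMem hx, norm_zero]
          exact ha)
  have hi2 : Integrable ((Set.Ioi a).indicator fun _ : ℝ => a) (returnLaw μ P X k) :=
    (integrable_const a).indicator measurableSet_Ioi
  rw [integral_add hi1 hi2, integral_indicator measurableSet_Icc,
    integral_indicator_const _ measurableSet_Ioi, sHat, pCdf, ← Set.compl_Iic,
    probReal_compl_eq_one_sub measurableSet_Iic, smul_eq_mul, mul_comm a]

end Model

/-! ### Sample paths of the TTL algorithms -/

section Paths

variable {K T : ℕ}

/-- Request `j` is the first request after `l` for the same object. -/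
def IsNext (c : ℕ → Obj K T) (l j : ℕ) : Prop :=
  l < j ∧ c j = c l ∧ ∀ i, l < i → i < j → c i ≠ c l

theorem IsNext.right_unique {c : ℕ → Obj K T} {l j j' : ℕ} (h : IsNext c l j) (h' : IsNext c l j') :
    j = j' := by
  rcases lt_trichotomy j j' with hlt | rfl | hlt
  · exact absurd h.2.1 (h'.2.2 j h.1 hlt)
  · rfl
  · exact absurd h'.2.1 (h.2.2 j' h'.1 hlt)

theorem IsNext.left_unique {c : ℕ → Obj K T} {l l' j : ℕ} (h : IsNext c l j) (h' : IsNext c l' j) :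
    l = l' := by
  have he : c l = c l' := h.2.1.symm.trans h'.2.1
  rcases lt_trichotomy l l' with hlt | rfl | hlt
  · exact absurd he.symm (h.2.2 l' hlt h'.1)
  · rfl
  · exact absurd he (h'.2.2 l hlt h.1)

theorem exists_last_request (c : ℕ → Obj K T) (o : Obj K T) (n : ℕ) :
    (∀ i < n, c i ≠ o) ∨ ∃ l < n, c l = o ∧ ∀ i, l < i → i < n → c i ≠ o := by
  induction n with
  | zero => exact .inl fun i hi => absurd hi (Nat.not_lt_zero i)
  | succ n ih =>
    by_cases hn : c n = o
    · exact .inr ⟨n, n.lt_succ_self, hn, fun i h1 h2 => absurd h1 (by omega)⟩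
    · rcases ih with ih | ⟨l, hl, hlo, ih⟩
      · refine .inl fun i hi => ?_
        rcases Nat.lt_succ_iff_lt_or_eq.1 hi with hi | rfl
        exacts [ih i hi, hn]
      · refine .inr ⟨l, hl.trans n.lt_succ_self, hlo, fun i h1 hi => ?_⟩
        rcases Nat.lt_succ_iff_lt_or_eq.1 hi with hi | rfl
        exacts [ih i h1 hi, hn]

theorem exists_isNext_left (c : ℕ → Obj K T) (j : ℕ) :
    (∀ i < j, c i ≠ c j) ∨ ∃ l, IsNext c l j := by
  rcases exists_last_request c (c j) j with h | ⟨l, hl, hlo, h⟩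
  · exact .inl h
  · exact .inr ⟨l, hl, hlo.symm, fun i h1 h2 => hlo ▸ h i h1 h2⟩

theorem exists_isNext_right (c : ℕ → Obj K T) (l : ℕ) :
    (∀ j, l < j → c j ≠ c l) ∨ ∃ j, IsNext c l j := by
  classical
  by_cases h : ∃ j, l < j ∧ c j = c l
  · refine .inr ⟨Nat.find h, (Nat.find_spec h).1, (Nat.find_spec h).2, fun i h1 h2 h3 => ?_⟩
    exact Nat.find_min h h2 ⟨h1, h3⟩
  · push Not at h
    exact .inl h

variable {x : ℕ → ℝ}

theorem arrival_succ (x : ℕ → ℝ) (n : ℕ) : arrival x (n + 1) = arrival x n + x n :=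
  Finset.sum_range_succ _ _

theorem monotone_arrival (hx : ∀ l, 0 ≤ x l) : Monotone (arrival x) :=
  monotone_nat_of_le_succ fun n => by
    rw [arrival_succ]
    linarith [hx n]

theorem arrival_nonneg (hx : ∀ l, 0 ≤ x l) (n : ℕ) : 0 ≤ arrival x n :=
  Finset.sum_nonneg fun i _ => hx i

/-- Request `l` arrives less than `a` time units after the preceding request for its object. -/
def Recent (x : ℕ → ℝ) (c : ℕ → Obj K T) (a : ℝ) (l : ℕ) : Prop :=
  ∃ l', IsNext c l' l ∧ arrival x (l + 1) - arrival x (l' + 1) < a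

variable (M : Catalog K T) (θ θs : Fin T → ℝ)

open Classical in
/-- The TTL during which f-TTL caches the object of request `l` after that request. -/
def ttl (x : ℕ → ℝ) (c : ℕ → Obj K T) (l : ℕ) : ℝ :=
  if Recent x c (θ (M.objType (c l))) l then θ (M.objType (c l)) else θs (M.objType (c l))

open Classical in
/-- The time for which f-TTL caches the object of request `l` until its next request. -/
def holding (x : ℕ → ℝ) (c : ℕ → Obj K T) (l : ℕ) : ℝ :=
  if h : ∃ j, IsNext c l j then min (ttl M θ θs x c l) (arrival x (h.choose + 1) - arrival x (l + 1))
  else ttl M θ θs x c l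

theorem Timers.age_age (ψ : Timers) (s : ℝ) {t : ℝ} (ht : 0 ≤ t) :
    (ψ.age s).age t = ψ.age (s + t) := by
  have : ∀ a : ℝ, max (max (a - s) 0 - t) 0 = max (a - (s + t)) 0 := fun a => by
    rcases le_total (a - s) 0 with h | h
    · rw [max_eq_right h, max_eq_right (by linarith), max_eq_right (by linarith)]
    · rw [max_eq_left h, sub_sub]
  simp only [Timers.age, this]

theorem Timers.cached_age_iff {ψ : Timers} {s : ℝ} :
    (ψ.age s).Cached ↔ s < ψ.deep ∨ s < ψ.shallow := by
  simp [Timers.age, Timers.Cached]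

theorem Timers.shadow_age_pos_iff {ψ : Timers} {s : ℝ} : 0 < (ψ.age s).shadow ↔ s < ψ.shadow := by
  simp [Timers.age]

theorem fTimers_succ_self (c : ℕ → Obj K T) (l : ℕ) :
    fTimers M θ θs x c (l + 1) (c l) = ((fTimers M θ θs x c l (c l)).age (x l)).request
      (θ (M.objType (c l))) (θs (M.objType (c l))) := by
  simp [fTimers]

theorem fTimers_succ_of_ne {c : ℕ → Obj K T} {l : ℕ} {o : Obj K T} (h : c l ≠ o) :
    fTimers M θ θs x c (l + 1) o = (fTimers M θ θs x c l o).age (x l) := by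
  simp [fTimers, Function.update_of_ne h.symm]

variable {M θ θs}

theorem fTimers_of_not_requested (hx : ∀ l, 0 ≤ x l) {c : ℕ → Obj K T} {o : Obj K T} {n : ℕ}
    (h : ∀ i < n, c i ≠ o) : fTimers M θ θs x c n o = ⟨0, 0, 0⟩ := by
  induction n with
  | zero => rfl
  | succ n ih =>
    rw [fTimers_succ_of_ne M θ θs (h n n.lt_succ_self), ih fun i hi => h i (hi.trans n.lt_succ_self)]
    simp [Timers.age, hx n]

/-- Aging is additive, so between requests for `o` its timers depend only on the tuple set at the
last one and on the elapsed time. -/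
theorem fTimers_age_of_last (hx : ∀ l, 0 ≤ x l) {c : ℕ → Obj K T} {o : Obj K T} {l n : ℕ}
    (hln : l < n) (h : ∀ i, l < i → i < n → c i ≠ o) {s : ℝ} (hs : 0 ≤ s) :
    (fTimers M θ θs x c n o).age s =
      (fTimers M θ θs x c (l + 1) o).age (arrival x n + s - arrival x (l + 1)) := by
  induction n, (hln : l + 1 ≤ n) using Nat.le_induction generalizing s with
  | base => rw [add_sub_cancel_left]
  | succ n hn ih =>
    rw [fTimers_succ_of_ne M θ θs (h n hn n.lt_succ_self), Timers.age_age _ _ hs,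
      ih (fun i h1 (h2 : i < n) => h i h1 (h2.trans n.lt_succ_self)) (add_nonneg (hx n) hs), arrival_succ x n]
    congr 1
    ring

theorem fTimers_age_of_isNext (hx : ∀ l, 0 ≤ x l) {c : ℕ → Obj K T} {l' l : ℕ}
    (h : IsNext c l' l) : (fTimers M θ θs x c l (c l)).age (x l) =
      (fTimers M θ θs x c (l' + 1) (c l')).age (arrival x (l + 1) - arrival x (l' + 1)) := by
  rw [h.2.1, fTimers_age_of_last hx h.1 h.2.2 (hx l), arrival_succ x l]

theorem recent_iff {c : ℕ → Obj K T} {l' l : ℕ} (h : IsNext c l' l) {a : ℝ} :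
    Recent x c a l ↔ arrival x (l + 1) - arrival x (l' + 1) < a :=
  ⟨fun ⟨_, h1, h2⟩ => h.left_unique h1 ▸ h2, fun h2 => ⟨l', h, h2⟩⟩

theorem not_recent_of_first {c : ℕ → Obj K T} {l : ℕ} (h : ∀ i < l, c i ≠ c l) {a : ℝ} :
    ¬ Recent x c a l := fun ⟨l', h1, _⟩ => h l' h1.1 h1.2.1.symm

open Classical in
/-- The timers of an object just after it has been requested. -/
theorem fTimers_succ_self_eq (hx : ∀ l, 0 ≤ x l) (hθs : θs ≤ θ) (c : ℕ → Obj K T) (l : ℕ) :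
    fTimers M θ θs x c (l + 1) (c l) = if Recent x c (θ (M.objType (c l))) l
      then ⟨θ (M.objType (c l)), 0, 0⟩ else ⟨0, θs (M.objType (c l)), θ (M.objType (c l))⟩ := by
  induction l using Nat.strong_induction_on with
  | _ l ih =>
    rw [fTimers_succ_self]
    rcases exists_isNext_left c l with h | ⟨l', h⟩
    · rw [fTimers_of_not_requested hx h, if_neg (not_recent_of_first h)]
      simp [Timers.age, Timers.request, Timers.Cached, hx l]
    · have hle : 0 ≤ arrival x (l + 1) - arrival x (l' + 1) :=
        sub_nonneg.2 (monotone_arrival hx (by have := h.1; omega))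
      rw [fTimers_age_of_isNext hx h, ih l' h.1, recent_iff h, h.2.1]
      -- Either the deep timer or the shadow timer was set to `θ` at `l'`, and `θs ≤ θ`; so in both
      -- cases a hit or virtual hit occurs exactly when `G` is less than `θ`.
      set G := arrival x (l + 1) - arrival x (l' + 1)
      have hs := hθs (M.objType (c l'))
      simp only [Timers.request, Timers.cached_age_iff, Timers.shadow_age_pos_iff]
      by_cases hr : Recent x c (θ (M.objType (c l'))) l'
      · simp [hr, hle.not_gt]
      · simp only [hr, if_false, hle.not_gt, false_or]
        by_cases h1 : G < θs (M.objType (c l'))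
        · simp [h1, h1.trans_le hs]
        · simp [h1]

/-- Only one of the deep and shallow timers is ever started, so as far as the cached objects are
concerned the tuple reduces to the single number `ttl`. -/
theorem cached_age_fTimers_succ_self (hx : ∀ l, 0 ≤ x l) (hθs : θs ≤ θ) (c : ℕ → Obj K T)
    (l : ℕ) {s : ℝ} (hs : 0 ≤ s) :
    ((fTimers M θ θs x c (l + 1) (c l)).age s).Cached ↔ s < ttl M θ θs x c l := by
  rw [fTimers_succ_self_eq hx hθs, Timers.cached_age_iff, ttl]
  split_ifs <;> simp [hs.not_gt]

theorem fHit_iff (hx : ∀ l, 0 ≤ x l) (hθs : θs ≤ θ) {c : ℕ → Obj K T} {l : ℕ} :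
    fHit M θ θs x c l ↔
      ∃ l', IsNext c l' l ∧ arrival x (l + 1) - arrival x (l' + 1) < ttl M θ θs x c l' := by
  rcases exists_isNext_left c l with h | ⟨l', h⟩
  · refine iff_of_false ?_ fun ⟨l', h1, _⟩ => h l' h1.1 h1.2.1.symm
    rw [fHit, fTimers_of_not_requested hx h, Timers.cached_age_iff]
    simp [(hx l).not_gt]
  · have hle : 0 ≤ arrival x (l + 1) - arrival x (l' + 1) :=
      sub_nonneg.2 (monotone_arrival hx (by have := h.1; omega))
    rw [fHit, fTimers_age_of_isNext hx h, cached_age_fTimers_succ_self hx hθs c l' hle]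
    exact ⟨fun h1 => ⟨l', h, h1⟩, fun ⟨l'', h1, h2⟩ => h.left_unique h1 ▸ h2⟩

/-- With equal TTL values, f-TTL has the hits of d-TTL. -/
theorem dHit_iff_fHit (hθ : 0 ≤ θ) (c : ℕ → Obj K T) (l : ℕ) :
    dHit M θ x c l ↔ fHit M θ θ x c l := by
  -- With `θs = θ` every request sets one of the deep and shallow timers to `θ` and the other to
  -- zero, so their maximum evolves as the d-TTL timer.
  have key : ∀ n o, dTimer M θ x c n o =
      max (fTimers M θ θ x c n o).deep (fTimers M θ θ x c n o).shallow := fun n => by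
    induction n with
    | zero => simp [dTimer, fTimers]
    | succ n ih =>
      intro o
      by_cases ho : c n = o
      · subst ho
        have h0 := hθ (M.objType (c n))
        rw [Pi.zero_apply] at h0
        rw [fTimers_succ_self]
        simp only [dTimer, Function.update_self, Timers.request]
        split_ifs <;> simp [h0]
      · rw [fTimers_succ_of_ne M θ θ ho]
        simp only [dTimer, Function.update_of_ne (Ne.symm ho), ih, Timers.age]
        rw [← max_sub_sub_right, max_max_max_comm, max_self]
  rw [dHit, fHit, key, Timers.cached_age_iff, sub_pos, lt_max_iff]

theorem ttl_nonneg (h0 : 0 ≤ θs) (hθs : θs ≤ θ) (c : ℕ → Obj K T) (l : ℕ) :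
    0 ≤ ttl M θ θs x c l := by
  unfold ttl
  split_ifs
  · exact (h0 _).trans (hθs _)
  · exact h0 _

theorem ttl_le (hθs : θs ≤ θ) (c : ℕ → Obj K T) (l : ℕ) :
    ttl M θ θs x c l ≤ θ (M.objType (c l)) := by
  unfold ttl
  split_ifs
  · exact le_rfl
  · exact hθs _

theorem holding_of_isNext {c : ℕ → Obj K T} {l j : ℕ} (h : IsNext c l j) :
    holding M θ θs x c l = min (ttl M θ θs x c l) (arrival x (j + 1) - arrival x (l + 1)) := by
  have hex : ∃ j, IsNext c l j := ⟨j, h⟩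
  rw [holding, dif_pos hex, h.right_unique hex.choose_spec]

theorem holding_of_last {c : ℕ → Obj K T} {l : ℕ} (h : ∀ j, l < j → c j ≠ c l) :
    holding M θ θs x c l = ttl M θ θs x c l := by
  rw [holding, dif_neg fun ⟨j, hj⟩ => h j hj.1 hj.2.1]

theorem holding_nonneg (hx : ∀ l, 0 ≤ x l) (h0 : 0 ≤ θs) (hθs : θs ≤ θ) (c : ℕ → Obj K T)
    (l : ℕ) : 0 ≤ holding M θ θs x c l := by
  rcases exists_isNext_right c l with h | ⟨j, h⟩
  · rw [holding_of_last h]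
    exact ttl_nonneg h0 hθs c l
  · rw [holding_of_isNext h]
    exact le_min (ttl_nonneg h0 hθs c l)
      (sub_nonneg.2 (monotone_arrival hx (by have := h.1; omega)))

theorem holding_le_ttl (c : ℕ → Obj K T) (l : ℕ) :
    holding M θ θs x c l ≤ ttl M θ θs x c l := by
  rcases exists_isNext_right c l with h | ⟨j, h⟩
  · rw [holding_of_last h]
  · rw [holding_of_isNext h]
    exact min_le_left _ _

/-- Expresses the end of a holding period without reference to a chosen next request, which also
covers objects that are never requested again. -/
theorem lt_add_holding_iff (hx : ∀ l, 0 ≤ x l) {c : ℕ → Obj K T} {l : ℕ} {u : ℝ} :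
    u < arrival x (l + 1) + holding M θ θs x c l ↔ u < arrival x (l + 1) + ttl M θ θs x c l ∧
      ∀ j, l < j → c j = c l → u < arrival x (j + 1) := by
  rcases exists_isNext_right c l with h | ⟨j, h⟩
  · rw [holding_of_last h]
    exact ⟨fun hu => ⟨hu, fun j h1 h2 => absurd h2 (h j h1)⟩, fun hu => hu.1⟩
  · rw [holding_of_isNext h, ← min_add_add_left, lt_min_iff, add_sub_cancel]
    refine and_congr_right fun _ => ⟨fun hu i h1 h2 => hu.trans_le (monotone_arrival hx ?_),
      fun hu => hu j h.1 h.2.1⟩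
    by_contra hij
    exact h.2.2 i h1 (by omega) h2

/-- The number of requests up to time `u`. -/
def count (x : ℕ → ℝ) (u : ℝ) : ℕ := sInf {n | u < arrival x (n + 1)}

/-- Divergence of the arrival times makes the infimum in `count` one over a nonempty set. Later
arguments use `count` through this equivalence. -/
theorem lt_count_iff (hx : ∀ l, 0 ≤ x l) (hlim : Tendsto (arrival x) atTop atTop) {u : ℝ} {l : ℕ} :
    l < count x u ↔ arrival x (l + 1) ≤ u := by
  have hne : {n | u < arrival x (n + 1)}.Nonempty :=
    (((tendsto_add_atTop_iff_nat 1).2 hlim).eventually_gt_atTop u).exists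
  constructor
  · intro h
    simpa using Nat.notMem_of_lt_sInf h
  · intro h
    by_contra hle
    have h1 : u < arrival x (count x u + 1) := Nat.sInf_mem hne
    exact absurd (h1.trans_le (monotone_arrival hx (by omega))) (not_lt.2 h)

theorem lt_arrival_count_succ (hx : ∀ l, 0 ≤ x l) (hlim : Tendsto (arrival x) atTop atTop)
    (u : ℝ) : u < arrival x (count x u + 1) :=
  not_le.1 ((lt_count_iff hx hlim).not.1 (lt_irrefl _))

theorem arrival_count_le (hx : ∀ l, 0 ≤ x l) (hlim : Tendsto (arrival x) atTop atTop) {u : ℝ}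
    (hu : 0 ≤ u) : arrival x (count x u) ≤ u := by
  rcases h : count x u with _ | n
  · simpa [arrival] using hu
  · exact (lt_count_iff hx hlim).1 (by omega)

/-- The last request for `o` up to time `u` determines its timers, and its holding interval ends at
the next request or at the expiry of the TTL, whichever comes first. -/
theorem mem_fCache_iff (hx : ∀ l, 0 ≤ x l) (hlim : Tendsto (arrival x) atTop atTop)
    (hθs : θs ≤ θ) {c : ℕ → Obj K T} {u : ℝ} (hu : 0 ≤ u) {o : Obj K T} :
    o ∈ fCache M θ θs x c u ↔
      ∃ l, c l = o ∧ arrival x (l + 1) ≤ u ∧ u < arrival x (l + 1) + holding M θ θs x c l := by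
  constructor
  · rintro ⟨n, h1, h2, h3⟩
    rcases exists_last_request c o n with h | ⟨l, hl, rfl, h⟩
    · rw [fTimers_of_not_requested hx h, Timers.cached_age_iff] at h3
      simp only [or_self] at h3
      linarith
    · have hlu : arrival x (l + 1) ≤ u := (monotone_arrival hx (by omega)).trans h1
      rw [fTimers_age_of_last hx hl h (sub_nonneg.2 h1), add_sub_cancel,
        cached_age_fTimers_succ_self hx hθs c l (sub_nonneg.2 hlu)] at h3
      refine ⟨l, rfl, hlu, (lt_add_holding_iff hx).2 ⟨by linarith, fun j h4 h5 => ?_⟩⟩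
      refine h2.trans_le (monotone_arrival hx ?_)
      by_contra hjn
      exact h j h4 (by omega) h5
  · rintro ⟨l, rfl, h1, h2⟩
    obtain ⟨h3, h4⟩ := (lt_add_holding_iff hx).1 h2
    have hln : l < count x u := (lt_count_iff hx hlim).2 h1
    have hn := arrival_count_le hx hlim hu
    refine ⟨count x u, hn, lt_arrival_count_succ hx hlim u, ?_⟩
    rw [fTimers_age_of_last hx hln (fun i h5 h6 h7 => ?_) (sub_nonneg.2 hn), add_sub_cancel,
      cached_age_fTimers_succ_self hx hθs c l (sub_nonneg.2 h1)]
    · linarith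
    · exact absurd ((lt_count_iff hx hlim).1 h6) (not_le.2 (h4 i h5 h7))

end Paths

/-! ### From averages over requests to averages over time -/

section Performance

variable {K T : ℕ} {M : Catalog K T} {θ θs : Fin T → ℝ} {x : ℕ → ℝ}

open Classical in
theorem requestWeight_eq (hx : ∀ l, 0 ≤ x l) (hlim : Tendsto (arrival x) atTop atTop)
    (c : ℕ → Obj K T) (w : Obj K T → ℝ) (Y : ℕ → Prop) (t : Fin T) (τ : ℝ) :
    requestWeight M x c w Y t τ = ∑ l ∈ Finset.range (count x τ),
      if M.objType (c l) = t ∧ Y l then w (c l) else 0 := by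
  rw [requestWeight, tsum_eq_sum (s := Finset.range (count x τ))]
  · refine Finset.sum_congr rfl fun l hl => ?_
    have := (lt_count_iff hx hlim).1 (Finset.mem_range.1 hl)
    simp [this]
  · intro l hl
    rw [Finset.mem_range, lt_count_iff hx hlim] at hl
    simp [hl]

theorem count_mono (hx : ∀ l, 0 ≤ x l) (hlim : Tendsto (arrival x) atTop atTop) :
    Monotone (count x) := fun u v huv => by
  by_contra! h
  exact lt_irrefl _ ((lt_count_iff hx hlim).2 (((lt_count_iff hx hlim).1 h).trans huv))

theorem tendsto_count (hx : ∀ l, 0 ≤ x l) (hlim : Tendsto (arrival x) atTop atTop) :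
    Tendsto (count x) atTop atTop :=
  tendsto_atTop_atTop_of_monotone (count_mono hx hlim) fun n =>
    ⟨arrival x (n + 1), ((lt_count_iff hx hlim).2 le_rfl).le⟩

open Classical in
/-- The total size in the cache, as a sum over the past requests. -/
theorem tsum_fCache_eq (hx : ∀ l, 0 ≤ x l) (hlim : Tendsto (arrival x) atTop atTop)
    (hθs : θs ≤ θ) (c : ℕ → Obj K T) (t : Fin T) {u τ : ℝ} (hu : 0 ≤ u) (huτ : u ≤ τ) :
    (∑' o : Obj K T, if o ∈ fCache M θ θs x c u ∧ M.objType o = t then M.objSize o else 0) =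
      ∑ l ∈ Finset.range (count x τ), (Set.Ico (arrival x (l + 1))
        (arrival x (l + 1) + holding M θ θs x c l)).indicator
          (fun _ => if M.objType (c l) = t then M.objSize (c l) else 0) u := by
  have hobj : ∀ o : Obj K T,
      (if o ∈ fCache M θ θs x c u ∧ M.objType o = t then M.objSize o else 0) =
      ∑ l ∈ Finset.range (count x τ), if o = c l then (Set.Ico (arrival x (l + 1))
        (arrival x (l + 1) + holding M θ θs x c l)).indicator
          (fun _ => if M.objType (c l) = t then M.objSize (c l) else 0) u else 0 := fun o => by
    by_cases ho : o ∈ fCache M θ θs x c u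
    · obtain ⟨l, rfl, h1, h2⟩ := (mem_fCache_iff hx hlim hθs hu).1 ho
      rw [Finset.sum_eq_single l]
      · rw [if_pos rfl, Set.indicator_of_mem (Set.mem_Ico.2 ⟨h1, h2⟩)]
        simp [ho]
      -- Holding intervals of different requests for one object are disjoint, as each ends no later
      -- than the next request for it; so a cached object is counted once.
      · intro l' _ hne
        by_cases hc : c l = c l'
        · rw [if_pos hc, Set.indicator_of_notMem]
          rintro ⟨h3, h4⟩
          rcases lt_or_gt_of_ne hne with hlt | hlt
          · exact absurd (((lt_add_holding_iff hx).1 h4).2 l hlt hc) (not_lt.2 h1)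
          · exact absurd (((lt_add_holding_iff hx).1 h2).2 l' hlt hc.symm) (not_lt.2 h3)
        · rw [if_neg hc]
      · intro hl
        exact absurd (Finset.mem_range.2 ((lt_count_iff hx hlim).2 (h1.trans huτ))) hl
    · rw [if_neg fun h => ho h.1, Finset.sum_eq_zero]
      intro l _
      by_cases hc : o = c l
      · rw [if_pos hc, Set.indicator_of_notMem]
        exact fun h => ho ((mem_fCache_iff hx hlim hθs hu).2 ⟨l, hc.symm, h.1, h.2⟩)
      · rw [if_neg hc]
  simp_rw [hobj]
  rw [Summable.tsum_finsetSum fun l _ => (hasSum_ite_eq (c l) _).summable]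
  exact Finset.sum_congr rfl fun l _ => tsum_ite_eq _ _

open Classical in
-- A holding interval has length at most `θ t`: those starting by `τ - θ t` are contained in `[0,
-- τ]`, and the others contribute at most their length.
theorem integral_fCache_bounds (hx : ∀ l, 0 ≤ x l) (hlim : Tendsto (arrival x) atTop atTop)
    (h0 : 0 ≤ θs) (hθs : θs ≤ θ) (c : ℕ → Obj K T) (t : Fin T) {τ : ℝ} (hτ : 0 ≤ τ) :
    (∑ l ∈ Finset.range (count x (τ - θ t)),
      if M.objType (c l) = t then M.objSize (c l) * holding M θ θs x c l else 0) ≤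
    (∫ u in (0 : ℝ)..τ, ∑' o : Obj K T,
      if o ∈ fCache M θ θs x c u ∧ M.objType o = t then M.objSize o else 0) ∧
    (∫ u in (0 : ℝ)..τ, ∑' o : Obj K T,
      if o ∈ fCache M θ θs x c u ∧ M.objType o = t then M.objSize o else 0) ≤
    ∑ l ∈ Finset.range (count x τ),
      if M.objType (c l) = t then M.objSize (c l) * holding M θ θs x c l else 0 := by
  have hsize : ∀ o, 0 ≤ M.objSize o := by
    rintro (k | r)
    · exact (M.size_pos k).le
    · exact (M.rareSize_pos r.1).le
  set I : ℕ → Set ℝ := fun l => Set.Ico (arrival x (l + 1))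
    (arrival x (l + 1) + holding M θ θs x c l) with hI
  have hd := holding_nonneg (M := M) hx h0 hθs c
  have hint : (∫ u in (0 : ℝ)..τ, ∑' o : Obj K T,
      if o ∈ fCache M θ θs x c u ∧ M.objType o = t then M.objSize o else 0) =
      ∑ l ∈ Finset.range (count x τ), if M.objType (c l) = t then
        M.objSize (c l) * (volume.restrict (Set.Ioc 0 τ)).real (I l) else 0 := by
    rw [intervalIntegral.integral_of_le hτ,
      setIntegral_congr_fun measurableSet_Ioc fun u hu =>
        tsum_fCache_eq hx hlim hθs c t hu.1.le hu.2,
      integral_finsetSum _ fun l _ => (integrable_const _).indicator measurableSet_Ico]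
    refine Finset.sum_congr rfl fun l _ => ?_
    rw [integral_indicator_const _ measurableSet_Ico, smul_eq_mul]
    split_ifs
    · rw [mul_comm]
    · rw [mul_zero]
  rw [hint]
  constructor
  · refine (Finset.sum_le_sum fun l hl => ?_).trans (Finset.sum_le_sum_of_subset_of_nonneg
      (Finset.range_mono (count_mono hx hlim (sub_le_self τ ((h0.trans hθs) t)))) fun l _ _ => ?_)
    · by_cases ht : M.objType (c l) = t
      · rw [if_pos ht, if_pos ht]
        refine mul_le_mul_of_nonneg_left ?_ (hsize _)
        have h1 := (lt_count_iff hx hlim).1 (Finset.mem_range.1 hl)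
        have h2 : holding M θ θs x c l ≤ θ t := ht ▸ (holding_le_ttl c l).trans (ttl_le hθs c l)
        have h3 := arrival_nonneg hx (l + 1)
        have hsub : Set.Ioo (arrival x (l + 1)) (arrival x (l + 1) + holding M θ θs x c l) ⊆
            I l ∩ Set.Ioc 0 τ := fun u hu =>
          ⟨⟨hu.1.le, hu.2⟩, h3.trans_lt hu.1, by linarith [hu.2]⟩
        rw [measureReal_restrict_apply measurableSet_Ico]
        have h4 := measureReal_mono (μ := volume) hsub
          (ne_top_of_le_ne_top (by simp) (measure_mono Set.inter_subset_right))
        rwa [Real.volume_real_Ioo_of_le (by linarith [hd l]), add_sub_cancel_left] at h4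
      · rw [if_neg ht, if_neg ht]
    · split_ifs
      · exact mul_nonneg (hsize _) measureReal_nonneg
      · exact le_rfl
  · refine Finset.sum_le_sum fun l _ => ?_
    split_ifs
    · refine mul_le_mul_of_nonneg_left ?_ (hsize _)
      rw [measureReal_restrict_apply measurableSet_Ico]
      have h4 := measureReal_mono (μ := volume) (Set.inter_subset_left (s := I l) (t := Set.Ioc 0 τ))
        (by simp [hI])
      rwa [hI, Real.volume_real_Ico_of_le (by linarith [hd l]), add_sub_cancel_left] at h4
    · exact le_rfl

theorem tendsto_arrival_atTop {m : ℝ} (hm : 0 < m)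
    (h : Tendsto (fun n : ℕ => arrival x n / n) atTop (𝓝 m)) : Tendsto (arrival x) atTop atTop := by
  refine (h.pos_mul_atTop hm tendsto_natCast_atTop_atTop).congr' ?_
  filter_upwards [eventually_gt_atTop 0] with n hn
  have : (n : ℝ) ≠ 0 := by positivity
  field_simp

/-- Time `τ` lies between the arrivals numbered `count x τ` and `count x τ + 1`, so the law of large
numbers for arrivals can be inverted. -/
theorem tendsto_count_div (hx : ∀ l, 0 ≤ x l) {m : ℝ} (hm : 0 < m)
    (h : Tendsto (fun n : ℕ => arrival x n / n) atTop (𝓝 m)) :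
    Tendsto (fun τ => (count x τ : ℝ) / τ) atTop (𝓝 m⁻¹) := by
  have hlim := tendsto_arrival_atTop hm h
  have hN := tendsto_count hx hlim
  have h1 : Tendsto (fun n : ℕ => arrival x (n + 1) / n) atTop (𝓝 m) := by
    have e := ((tendsto_add_atTop_iff_nat 1).2 h).mul
      ((tendsto_one_div_atTop_nhds_zero_nat (𝕜 := ℝ)).const_add 1)
    rw [add_zero, mul_one] at e
    refine e.congr' ?_
    filter_upwards [eventually_gt_atTop 0] with n hn
    have : (n : ℝ) ≠ 0 := by positivity
    push_cast
    field_simp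
  have h2 : Tendsto (fun τ => τ / (count x τ : ℝ)) atTop (𝓝 m) := by
    refine tendsto_of_tendsto_of_tendsto_of_le_of_le' (h.comp hN) (h1.comp hN) ?_ ?_
    · filter_upwards [eventually_ge_atTop 0] with τ hτ
      exact div_le_div_of_nonneg_right (arrival_count_le hx hlim hτ) (Nat.cast_nonneg _)
    · exact .of_forall fun τ =>
        div_le_div_of_nonneg_right (lt_arrival_count_succ hx hlim τ).le (Nat.cast_nonneg _)
  exact (h2.inv₀ hm.ne').congr fun τ => inv_div _ _

theorem tendsto_count_sub_div_count (hx : ∀ l, 0 ≤ x l) {m : ℝ} (hm : 0 < m)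
    (h : Tendsto (fun n : ℕ => arrival x n / n) atTop (𝓝 m)) (b : ℝ) :
    Tendsto (fun τ => (count x (τ - b) : ℝ) / count x τ) atTop (𝓝 1) := by
  have h1 := tendsto_count_div hx hm h
  have h2 := h1.comp (tendsto_atTop_add_const_right atTop (-b) tendsto_id)
  have h3 : Tendsto (fun τ : ℝ => (τ - b) / τ) atTop (𝓝 1) := by
    have := (tendsto_inv_atTop_zero.const_mul b).const_sub (1 : ℝ)
    rw [mul_zero, sub_zero] at this
    refine this.congr' ?_
    filter_upwards [eventually_gt_atTop 0] with τ hτ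
    field_simp
  have h4 := (h2.mul h3).div h1 (inv_ne_zero hm.ne')
  rw [mul_one, div_self (inv_ne_zero hm.ne')] at h4
  refine h4.congr' ?_
  filter_upwards [eventually_gt_atTop 0, eventually_gt_atTop b,
    (tendsto_count hx (tendsto_arrival_atTop hm h)).eventually_gt_atTop 0] with τ hτ hb hN
  have hN' : (count x τ : ℝ) ≠ 0 := by positivity
  have hb' : τ - b ≠ 0 := by linarith
  simp only [Function.comp, id, Pi.div_apply, ← sub_eq_add_neg]
  field_simp

theorem sum_range_eq_avg_mul (y : ℕ → ℝ) (n : ℕ) : ∑ l ∈ Finset.range n, y l = avg y n * n := by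
  rcases Nat.eq_zero_or_pos n with rfl | hn
  · simp
  · rw [avg, div_mul_cancel₀]
    positivity

open Classical in
theorem hitRate_eq (hx : ∀ l, 0 ≤ x l) (hlim : Tendsto (arrival x) atTop atTop)
    {c : ℕ → Obj K T} {κ : HitKind} {Y : ℕ → Prop} {t : Fin T} {a w : ℝ} (hw : w ≠ 0)
    (hY : Tendsto (avg fun l => if M.objType (c l) = t then
      hitWeight M κ (c l) * (if Y l then 1 else 0) else 0) atTop (𝓝 a))
    (hW : Tendsto (avg fun l => if M.objType (c l) = t then hitWeight M κ (c l) * 1 else 0)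
      atTop (𝓝 w)) :
    hitRate M x c κ Y t = ((a / w : ℝ) : EReal) := by
  refine Tendsto.liminf_eq (continuous_coe_real_ereal.tendsto _ |>.comp ?_)
  have hN := tendsto_count hx hlim
  refine ((hY.comp hN).div (hW.comp hN) hw).congr' ?_
  filter_upwards [hN.eventually_gt_atTop 0] with τ hτ
  have : (count x τ : ℝ) ≠ 0 := by positivity
  rw [requestWeight_eq hx hlim, requestWeight_eq hx hlim]
  simp only [Function.comp, Pi.div_apply, avg, div_div_div_cancel_right₀ this, and_true, mul_one,
    mul_ite, mul_zero, ite_and]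

open Classical in
theorem normalizedSize_fCache_eq (hx : ∀ l, 0 ≤ x l) {m : ℝ} (hm : 0 < m)
    (h : Tendsto (fun n : ℕ => arrival x n / n) atTop (𝓝 m)) (h0 : 0 ≤ θs) (hθs : θs ≤ θ)
    {c : ℕ → Obj K T} {t : Fin T} {a w : ℝ} (hw : w ≠ 0)
    (hY : Tendsto (avg fun l => if M.objType (c l) = t then
      M.objSize (c l) * holding M θ θs x c l else 0) atTop (𝓝 a))
    (hW : Tendsto (avg fun l => if M.objType (c l) = t then M.objSize (c l) * 1 else 0)
      atTop (𝓝 w)) :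
    normalizedSize M x c (fCache M θ θs x c) t = ((a / w : ℝ) : EReal) := by
  have hlim := tendsto_arrival_atTop hm h
  have hN := tendsto_count hx hlim
  refine Tendsto.limsup_eq (continuous_coe_real_ereal.tendsto _ |>.comp ?_)
  -- The lower sum runs over fewer requests, but a fixed time shift changes the number of requests
  -- by a factor tending to one.
  have hlow : Tendsto (fun τ => avg (fun l => if M.objType (c l) = t then
      M.objSize (c l) * holding M θ θs x c l else 0) (count x (τ - θ t)) *
      ((count x (τ - θ t) : ℝ) / count x τ)) atTop (𝓝 a) := by
    have hs : Tendsto (fun τ : ℝ => τ - θ t) atTop atTop :=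
      tendsto_atTop_add_const_right atTop (-θ t) tendsto_id
    simpa using ((hY.comp hN).comp hs).mul (tendsto_count_sub_div_count hx hm h (θ t))
  have hI : Tendsto (fun τ => (∫ u in (0 : ℝ)..τ, ∑' o : Obj K T,
      if o ∈ fCache M θ θs x c u ∧ M.objType o = t then M.objSize o else 0) / count x τ)
      atTop (𝓝 a) := by
    refine tendsto_of_tendsto_of_tendsto_of_le_of_le' hlow (hY.comp hN) ?_ ?_
    · filter_upwards [eventually_ge_atTop 0] with τ hτ
      rw [← mul_div_assoc, ← sum_range_eq_avg_mul]
      exact div_le_div_of_nonneg_right (integral_fCache_bounds hx hlim h0 hθs c t hτ).1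
        (Nat.cast_nonneg _)
    · filter_upwards [eventually_ge_atTop 0] with τ hτ
      exact div_le_div_of_nonneg_right (integral_fCache_bounds hx hlim h0 hθs c t hτ).2
        (Nat.cast_nonneg _)
  refine (hI.div (hW.comp hN) hw).congr' ?_
  filter_upwards [hN.eventually_gt_atTop 0] with τ hτ
  have : (count x τ : ℝ) ≠ 0 := by positivity
  rw [requestWeight_eq hx hlim]
  simp only [Function.comp, Pi.div_apply, avg, div_div_div_cancel_right₀ this, and_true, mul_one]

end Performance

/-! ### Past gaps and shifts to the next visit -/

section RecentVisits

variable {S : Type*}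

/-- The path `z` visits `k` less than `a` time units before `l`, with no visit in between. -/
def RecentVisit (x : ℕ → ℝ) (z : ℕ → S) (k : S) (a : ℝ) (l : ℕ) : Prop :=
  ∃ l' ∈ Finset.range l, z l' = k ∧ ReturnsAt z k (l - l' - 1) l' ∧ window x l' (l - l' - 1) < a

/-- Whether the preceding gap was short is known at time `l`, which makes it an admissible weight in
the strong law for the following gap. -/
theorem measurableSet_recentVisit {Ω : Type*} [MeasurableSpace S] [DiscreteMeasurableSpace S]
    (X : ℕ → Ω → ℝ) (Z : ℕ → Ω → S) (k : S) (a : ℝ) (l : ℕ) :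
    MeasurableSet[hist X Z (Set.Iic l) (Set.Iic l)]
      {ω | RecentVisit (fun i => X i ω) (fun i => Z i ω) k a l} := by
  have hk : ∀ {i : ℕ}, i ≤ l → MeasurableSet[hist X Z (Set.Iic l) (Set.Iic l)] {ω | Z i ω = k} :=
    fun {i} hi => (measurable_hist_Z (Set.mem_Iic.2 hi) :
      Measurable[hist X Z (Set.Iic l) (Set.Iic l)] (Z i)) (MeasurableSet.singleton k)
  have hset : {ω | RecentVisit (fun i => X i ω) (fun i => Z i ω) k a l} =
      ⋃ l' ∈ Finset.range l, ({ω | Z l' ω = k} ∩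
        ((⋂ i ∈ Finset.range (l - l' - 1), {ω | Z (l' + 1 + i) ω = k}ᶜ) ∩
          {ω | Z (l' + 1 + (l - l' - 1)) ω = k})) ∩
          {ω | window (fun i => X i ω) l' (l - l' - 1) < a} := by
    ext ω
    simp only [RecentVisit, ReturnsAt, Set.mem_ofPred_eq, Set.mem_iUnion, Set.mem_inter_iff,
      Set.mem_iInter, Set.mem_compl_iff, Finset.mem_range, exists_prop, and_assoc, ne_eq]
  rw [hset]
  refine Finset.measurableSet_biUnion _ fun l' hl' => ?_
  rw [Finset.mem_range] at hl'
  refine ((hk hl'.le).inter (MeasurableSet.inter ?_ (hk (by omega)))).inter ?_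
  · exact Finset.measurableSet_biInter _ fun i hi => (hk (by
      rw [Finset.mem_range] at hi
      omega)).compl
  · have hw : Measurable[hist X Z (Set.Iic l) (Set.Iic l)]
        fun ω => window (fun i => X i ω) l' (l - l' - 1) :=
      Finset.measurable_sum _ fun i hi => measurable_hist_X (Set.mem_Iic.2 (by
        rw [Finset.mem_range] at hi
        omega))
    exact hw measurableSet_Iio

/-- Summing the values of `b` at the visits to `k`, or the values at the next visits, makes a
bounded difference. -/
theorem abs_sum_next_sub_le [DecidableEq S] {z : ℕ → S} {k : S} {q b : ℕ → ℝ} {C : ℝ}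
    (hq0 : ∀ l, z l ≠ k → q l = 0) (hb0 : ∀ l, z l ≠ k → b l = 0)
    (h : ∀ l m, z l = k → ReturnsAt z k m l → q l = b (l + m + 1))
    (hqC : ∀ l, |q l| ≤ C) (hbC : ∀ l, |b l| ≤ C) (n : ℕ) :
    |∑ l ∈ Finset.range n, q l - ∑ l ∈ Finset.range n, b l| ≤ C + C := by
  -- The sums telescope: `q` at a visit cancels `b` at the next one, leaving `q` at the last visit
  -- before `n` and `b` at the first.
  have key : ((∀ l < n, z l ≠ k) ∧
      ∑ l ∈ Finset.range n, q l - ∑ l ∈ Finset.range n, b l = 0) ∨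
      ∃ i < n, ∃ f, z i = k ∧ (∀ j, i < j → j < n → z j ≠ k) ∧
        ∑ l ∈ Finset.range n, q l - ∑ l ∈ Finset.range n, b l = q i - b f := by
    induction n with
    | zero => exact .inl ⟨fun l hl => absurd hl (Nat.not_lt_zero l), by simp⟩
    | succ n ih =>
      rw [Finset.sum_range_succ, Finset.sum_range_succ]
      by_cases hn : z n = k
      · right
        rcases ih with ⟨_, he⟩ | ⟨i, hi, f, hik, hij, he⟩
        · exact ⟨n, n.lt_succ_self, n, hn, fun j h1 h2 => absurd h1 (by omega), by linarith⟩
        · refine ⟨n, n.lt_succ_self, f, hn, fun j h1 h2 => absurd h1 (by omega), ?_⟩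
          have hr := h i (n - i - 1) hik ⟨fun j hj => hij _ (by omega) (by omega), by
            rwa [show i + 1 + (n - i - 1) = n by omega]⟩
          rw [show i + (n - i - 1) + 1 = n by omega] at hr
          linarith
      · rw [hq0 n hn, hb0 n hn]
        rcases ih with ⟨ha, he⟩ | ⟨i, hi, f, hik, hij, he⟩
        · refine .inl ⟨fun l hl => ?_, by linarith⟩
          rcases Nat.lt_succ_iff_lt_or_eq.1 hl with hl | rfl
          exacts [ha l hl, hn]
        · refine .inr ⟨i, hi.trans n.lt_succ_self, f, hik, fun j h1 h2 => ?_, by linarith⟩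
          rcases Nat.lt_succ_iff_lt_or_eq.1 h2 with h2 | rfl
          exacts [hij j h1 h2, hn]
  rcases key with ⟨-, he⟩ | ⟨i, -, f, -, -, he⟩
  · rw [he, abs_zero]
    have := (abs_nonneg _).trans (hqC 0)
    positivity
  · rw [he]
    exact (abs_sub _ _).trans (add_le_add (hqC i) (hbC f))

end RecentVisits

/-! ### Recurring objects as states of the chain -/

section StatePaths

variable {K T : ℕ} {M : Catalog K T} {θ θs : Fin T → ℝ} {x : ℕ → ℝ}

theorem stateOf_eq_inl_iff {o : Obj K T} {k : Fin K} : stateOf o = Sum.inl k ↔ o = Sum.inl k := by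
  rcases o with j | r <;> simp [stateOf]

theorem stateOf_eq_inr_iff {o : Obj K T} {t : Fin T} :
    stateOf o = Sum.inr t ↔ ∃ n, o = Sum.inr (t, n) := by
  rcases o with j | ⟨s, n⟩ <;> simp [stateOf]

theorem arrival_sub_arrival (x : ℕ → ℝ) (l m : ℕ) :
    arrival x (l + m + 1 + 1) - arrival x (l + 1) = window x l m := by
  rw [arrival, show l + m + 1 + 1 = l + 1 + (m + 1) by omega, Finset.sum_range_add, arrival, window,
    add_sub_cancel_left]

/-- A recurring object is determined by its state, so its gaps are excursions of the chain; a rare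
state would not identify the object. -/
theorem isNext_iff_returnsAt {c : ℕ → Obj K T} {k : Fin K} {l : ℕ} (hl : stateOf (c l) = Sum.inl k)
    (m : ℕ) : IsNext c l (l + m + 1) ↔ ReturnsAt (fun i => stateOf (c i)) (Sum.inl k) m l := by
  rw [stateOf_eq_inl_iff] at hl
  simp only [IsNext, ReturnsAt, stateOf_eq_inl_iff, hl, ne_eq]
  constructor
  · rintro ⟨-, h1, h2⟩
    exact ⟨fun i hi => h2 _ (by omega) (by omega), by rwa [show l + 1 + m = l + m + 1 by omega]⟩
  · rintro ⟨h1, h2⟩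
    refine ⟨by omega, by rwa [show l + m + 1 = l + 1 + m by omega], fun i h3 h4 => ?_⟩
    have := h1 (i - l - 1) (by omega)
    rwa [show l + 1 + (i - l - 1) = i by omega] at this

theorem recent_iff_recentVisit {c : ℕ → Obj K T} {k : Fin K} {l : ℕ}
    (hl : stateOf (c l) = Sum.inl k) (a : ℝ) :
    Recent x c a l ↔ RecentVisit x (fun i => stateOf (c i)) (Sum.inl k) a l := by
  constructor
  · rintro ⟨l', h1, h2⟩
    have hl' : stateOf (c l') = Sum.inl k := by rw [← h1.2.1, hl]
    have hlt := h1.1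
    have he : l' + (l - l' - 1) + 1 = l := by omega
    refine ⟨l', Finset.mem_range.2 hlt, hl', (isNext_iff_returnsAt hl' _).1 (by rwa [he]), ?_⟩
    rwa [← arrival_sub_arrival, he]
  · rintro ⟨l', h1, h2, h3, h4⟩
    have hlt := Finset.mem_range.1 h1
    have he : l' + (l - l' - 1) + 1 = l := by omega
    rw [← arrival_sub_arrival, he] at h4
    have := (isNext_iff_returnsAt h2 _).2 h3
    rw [he] at this
    exact ⟨l', this, h4⟩

end StatePaths

/-! ### Consecutive gaps of a recurring object -/

section Recurring

variable {K T : ℕ} {M : Catalog K T} {θ θs : Fin T → ℝ} {Ω : Type*} [MeasurableSpace Ω]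
  {μ : Measure Ω} [IsProbabilityMeasure μ] {P : Matrix (State K T) (State K T) ℝ}
  {X : ℕ → Ω → ℝ} {c : ℕ → Ω → Obj K T}

open Classical in
/-- The strong law for the times between requests of the recurring object `k`, on the requests for
which the preceding time was, or was not, less than `a`. -/
theorem RequestModel.ae_tendsto_recent (h : RequestModel μ P X c) (k : Fin K) (a : ℝ) (p : Prop)
    {v : ℝ → ℝ} (hv : Measurable v) {D : ℝ} (hvb : ∀ y, |v y| ≤ D) :
    ∀ᵐ ω ∂μ, ∀ (q : ℕ → ℝ) (C' : ℝ), (∀ l, |q l| ≤ C') →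
      (∀ l, stateOf (c l ω) ≠ Sum.inl k → q l = 0) →
      (∀ l m, stateOf (c l ω) = Sum.inl k → IsNext (fun i => c i ω) l (l + m + 1) →
        q l = (if Recent (fun i => X i ω) (fun i => c i ω) a l ↔ p then 1 else 0) *
          v (window (fun i => X i ω) l m)) →
      Tendsto (fun n => avg q n - (∫ y, v y ∂(returnLaw μ P X k)) *
        avg (fun l => if stateOf (c l ω) = Sum.inl k then
          if Recent (fun i => X i ω) (fun i => c i ω) a l ↔ p then 1 else 0 else 0) n)
        atTop (𝓝 0) := by
  have hin := h.markovInput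
  have hm := hin.ae_tendsto_next h.irreducible (C := 1)
    (a := fun l ω => if RecentVisit (fun i => X i ω) (fun i => stateOf (c i ω)) (Sum.inl k) a l ↔ p
      then 1 else 0)
    (fun l => by
      refine Measurable.ite ?_ measurable_const measurable_const
      have := measurableSet_recentVisit X (fun l ω => stateOf (c l ω)) (Sum.inl k) a l
      by_cases hp : p
      · simpa only [hp, iff_true] using this
      · simp only [hp, iff_false]
        exact this.compl)
    (fun l ω => by split_ifs <;> simp) hv hvb (Sum.inl k)
  filter_upwards [hm] with ω hω q C' hq h0 h1
  have := hω q C' hq h0 fun l m hz hr => by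
    rw [h1 l m hz ((isNext_iff_returnsAt hz m).2 hr), ← recent_iff_recentVisit hz]
  refine this.congr fun n => ?_
  congr 4
  funext l
  split_ifs with h2 h3 h4 h4
  all_goals first | rfl | (rw [recent_iff_recentVisit h2] at *; contradiction)

open Classical in
/-- The fraction of the requests that are for the recurring object `k` and arrive less than `a` time
units after the preceding one. -/
theorem RequestModel.ae_tendsto_avg_recent (h : RequestModel μ P X c) (k : Fin K) (a : ℝ) :
    ∀ᵐ ω ∂μ, ∀ p : Prop, Tendsto (avg fun l => if stateOf (c l ω) = Sum.inl k then
      if Recent (fun i => X i ω) (fun i => c i ω) a l ↔ p then 1 else 0 else 0) atTop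
      (𝓝 (stationary P (Sum.inl k) * if p then pCdf μ P X k a else 1 - pCdf μ P X k a)) := by
  have hm := h.markovInput.ae_tendsto_next h.irreducible (C := 1) (a := fun _ _ => 1)
    (fun l => measurable_const) (fun l ω => by simp) (v := fun y => if y < a then 1 else 0)
    (measurable_const.ite measurableSet_Iio measurable_const) (D := 1)
    (fun y => by split_ifs <;> simp) (Sum.inl k)
  filter_upwards [hm, (h.markovInput.ae_tendsto_occupation h.irreducible).2] with ω hω hocc
  have hocc := hocc (Sum.inl k)
  have h1 : Tendsto (avg fun l => if stateOf (c l ω) = Sum.inl k then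
      if Recent (fun i => X i ω) (fun i => c i ω) a l then (1 : ℝ) else 0 else 0) atTop
      (𝓝 (stationary P (Sum.inl k) * pCdf μ P X k a)) := by
    -- The strong law concerns the gap after a request, so it yields the frequency of requests whose
    -- following gap is short; `e2` moves this by one visit to the preceding gap.
    have e1 := hω (fun l => if stateOf (c l ω) = Sum.inl k then
      if ∃ m, IsNext (fun i => c i ω) l (l + m + 1) ∧ window (fun i => X i ω) l m < a
      then 1 else 0 else 0) 1 (fun l => by split_ifs <;> simp) (fun l hl => if_neg hl)
      (fun l m hz hr => by
        rw [if_pos hz, one_mul]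
        refine if_congr ⟨fun ⟨m', h1, h2⟩ => ?_, fun h2 =>
          ⟨m, (isNext_iff_returnsAt hz m).2 hr, h2⟩⟩ rfl rfl
        rwa [← ((isNext_iff_returnsAt hz m').1 h1).eq hr])
    change Tendsto (fun n => _ - (∫ y, (if y < a then 1 else 0) ∂(returnLaw μ P X k)) * _) _ _ at e1
    rw [h.integral_lt] at e1
    have e2 := tendsto_avg_sub_of_abs_sum_le (abs_sum_next_sub_le (z := fun i => stateOf (c i ω))
      (k := Sum.inl k) (q := fun l => if stateOf (c l ω) = Sum.inl k then
        if ∃ m, IsNext (fun i => c i ω) l (l + m + 1) ∧ window (fun i => X i ω) l m < a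
        then 1 else 0 else 0)
      (b := fun l => if stateOf (c l ω) = Sum.inl k then
        if Recent (fun i => X i ω) (fun i => c i ω) a l then 1 else 0 else 0) (C := 1)
      (fun l hl => if_neg hl) (fun l hl => if_neg hl)
      (fun l m hz hr => by
        have hnext := (isNext_iff_returnsAt hz m).2 hr
        have hz' : stateOf (c (l + m + 1) ω) = Sum.inl k :=
          (congrArg stateOf hnext.2.1).trans hz
        rw [if_pos hz, if_pos hz']
        refine if_congr ?_ rfl rfl
        rw [recent_iff hnext, arrival_sub_arrival]
        refine ⟨fun ⟨m', h1, h2⟩ => ?_, fun h2 => ⟨m, hnext, h2⟩⟩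
        rwa [← ((isNext_iff_returnsAt hz m').1 h1).eq hr])
      (fun l => by split_ifs <;> simp) (fun l => by split_ifs <;> simp))
    have e3 := (e1.sub e2).add (hocc.const_mul (pCdf μ P X k a))
    rw [sub_zero, zero_add, mul_comm] at e3
    refine e3.congr fun n => ?_
    ring
  intro p
  by_cases hp : p
  · simpa only [hp, iff_true, if_true] using h1
  · have e := hocc.sub h1
    simp only [hp, iff_false, if_false, mul_sub, mul_one]
    refine e.congr fun n => ?_
    rw [← avg_sub]
    congr 1
    funext l
    split_ifs <;> simp_all

end Recurring

/-! ### Hits and holding times of recurring objects -/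

section RecurringAverages

variable {K T : ℕ} {M : Catalog K T} {θ θs : Fin T → ℝ} {Ω : Type*} [MeasurableSpace Ω]
  {μ : Measure Ω} [IsProbabilityMeasure μ] {P : Matrix (State K T) (State K T) ℝ}
  {X : ℕ → Ω → ℝ} {c : ℕ → Ω → Obj K T}

open Classical in
/-- The average over the requests for `k` of `v₁` or `v₂` of the time until the next request, where
the choice depends on whether the preceding time was less than `a`. -/
theorem RequestModel.ae_tendsto_avg_recurring (h : RequestModel μ P X c) (k : Fin K) (a : ℝ)
    {v₁ v₂ : ℝ → ℝ} (hv₁ : Measurable v₁) (hv₂ : Measurable v₂) {D : ℝ} (hvb₁ : ∀ y, |v₁ y| ≤ D)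
    (hvb₂ : ∀ y, |v₂ y| ≤ D) :
    ∀ᵐ ω ∂μ, ∀ (q : ℕ → ℝ) (C' : ℝ), (∀ l, |q l| ≤ C') →
      (∀ l, stateOf (c l ω) ≠ Sum.inl k → q l = 0) →
      (∀ l m, stateOf (c l ω) = Sum.inl k → IsNext (fun i => c i ω) l (l + m + 1) →
        q l = if Recent (fun i => X i ω) (fun i => c i ω) a l then
          v₁ (window (fun i => X i ω) l m) else v₂ (window (fun i => X i ω) l m)) →
      Tendsto (avg q) atTop (𝓝 (stationary P (Sum.inl k) *
        (pCdf μ P X k a * (∫ y, v₁ y ∂(returnLaw μ P X k)) +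
          (1 - pCdf μ P X k a) * ∫ y, v₂ y ∂(returnLaw μ P X k)))) := by
  filter_upwards [h.ae_tendsto_recent k a True hv₁ hvb₁, h.ae_tendsto_recent k a False hv₂ hvb₂,
    h.ae_tendsto_avg_recent k a] with ω h1 h2 h3 q C' hq h0 hn
  have hC' : 0 ≤ C' := (abs_nonneg _).trans (hq 0)
  -- The sequence is split according to the preceding gap: this part carries `v₁`, and `e2` treats
  -- the part carrying `v₂`.
  have e1 := h1 (fun l => if Recent (fun i => X i ω) (fun i => c i ω) a l then q l else 0) C'
    (fun l => by split_ifs <;> simp [hq, hC']) (fun l hl => by rw [h0 l hl, ite_self])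
    fun l m hz hr => by
      rw [hn l m hz hr]
      simp only [iff_true]
      split_ifs <;> simp
  have e2 := h2 (fun l => if Recent (fun i => X i ω) (fun i => c i ω) a l then 0 else q l) C'
    (fun l => by split_ifs <;> simp [hq, hC']) (fun l hl => by rw [h0 l hl, ite_self])
    fun l m hz hr => by
      rw [hn l m hz hr]
      simp only [iff_false]
      split_ifs <;> simp
  have e3 := (h3 True).const_mul (∫ y, v₁ y ∂(returnLaw μ P X k))
  have e4 := (h3 False).const_mul (∫ y, v₂ y ∂(returnLaw μ P X k))
  have e5 := (e1.add e3).add (e2.add e4)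
  simp only [if_true, if_false, zero_add, sub_add_cancel] at e5
  have hlim : ∀ b c d e f : ℝ, b * (c * d) + e * (c * f) = c * (d * b + f * e) :=
    fun _ _ _ _ _ => by ring
  rw [hlim] at e5
  refine e5.congr fun n => ?_
  rw [← avg_add]
  congr 1
  funext l
  split_ifs <;> simp

open Classical in
-- The preceding gap selects the TTL and the following gap decides on a hit. The law of the
-- following gap gives the frequency of requests whose successor is a hit, and passing from a
-- request to its successor changes the sums by a bounded amount.
theorem RequestModel.ae_tendsto_avg_hit (h : RequestModel μ P X c) (M : Catalog K T)
    (hθs : θs ≤ θ) (k : Fin K) :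
    ∀ᵐ ω ∂μ, Tendsto (avg fun l => if stateOf (c l ω) = Sum.inl k then
      if fHit M θ θs (fun i => X i ω) (fun i => c i ω) l then 1 else 0 else 0) atTop
      (𝓝 (stationary P (Sum.inl k) * (pCdf μ P X k (θ (M.typ k)) ^ 2 +
        (1 - pCdf μ P X k (θ (M.typ k))) * pCdf μ P X k (θs (M.typ k))))) := by
  filter_upwards [h.ae_nonneg, h.ae_tendsto_avg_recurring k (θ (M.typ k))
    (v₁ := fun y => if y < θ (M.typ k) then 1 else 0)
    (v₂ := fun y => if y < θs (M.typ k) then 1 else 0)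
    (measurable_const.ite measurableSet_Iio measurable_const)
    (measurable_const.ite measurableSet_Iio measurable_const) (D := 1)
    (fun y => by split_ifs <;> simp) (fun y => by split_ifs <;> simp)] with ω hx hω
  have e1 := hω (fun l => if stateOf (c l ω) = Sum.inl k then
      if ∃ m, IsNext (fun i => c i ω) l (l + m + 1) ∧
        window (fun i => X i ω) l m < ttl M θ θs (fun i => X i ω) (fun i => c i ω) l
      then 1 else 0 else 0) 1 (fun l => by split_ifs <;> simp) (fun l hl => if_neg hl)
    fun l m hz hn => by
      have hex : (∃ m, IsNext (fun i => c i ω) l (l + m + 1) ∧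
          window (fun i => X i ω) l m < ttl M θ θs (fun i => X i ω) (fun i => c i ω) l) ↔
          window (fun i => X i ω) l m < ttl M θ θs (fun i => X i ω) (fun i => c i ω) l := by
        refine ⟨fun ⟨m', h1, h2⟩ => ?_, fun h2 => ⟨m, hn, h2⟩⟩
        have : m' = m := by
          have := h1.right_unique hn
          omega
        rwa [← this]
      have ho : M.objType (c l ω) = M.typ k := by rw [stateOf_eq_inl_iff.1 hz]; rfl
      rw [if_pos hz, if_congr hex rfl rfl, ttl, ho]
      split_ifs <;> rfl
  have e2 := tendsto_avg_sub_of_abs_sum_le (abs_sum_next_sub_le (z := fun i => stateOf (c i ω))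
    (k := Sum.inl k) (q := fun l => if stateOf (c l ω) = Sum.inl k then
      if ∃ m, IsNext (fun i => c i ω) l (l + m + 1) ∧
        window (fun i => X i ω) l m < ttl M θ θs (fun i => X i ω) (fun i => c i ω) l
      then 1 else 0 else 0)
    (b := fun l => if stateOf (c l ω) = Sum.inl k then
      if fHit M θ θs (fun i => X i ω) (fun i => c i ω) l then 1 else 0 else 0) (C := 1)
    (fun l hl => if_neg hl) (fun l hl => if_neg hl)
    (fun l m hz hr => by
      have hnext := (isNext_iff_returnsAt hz m).2 hr
      have hz' : stateOf (c (l + m + 1) ω) = Sum.inl k := (congrArg stateOf hnext.2.1).trans hz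
      rw [if_pos hz, if_pos hz']
      refine if_congr ?_ rfl rfl
      rw [fHit_iff hx hθs]
      constructor
      · rintro ⟨m', h1, h2⟩
        refine ⟨l, hnext, ?_⟩
        rw [arrival_sub_arrival]
        rwa [← ((isNext_iff_returnsAt hz m').1 h1).eq hr]
      · rintro ⟨l', h1, h2⟩
        obtain rfl := hnext.left_unique h1
        rw [arrival_sub_arrival] at h2
        exact ⟨m, hnext, h2⟩)
    (fun l => by split_ifs <;> simp) (fun l => by split_ifs <;> simp))
  have e3 := e1.sub e2
  rw [h.integral_lt, h.integral_lt, sub_zero, ← pow_two] at e3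
  exact e3.congr fun n => sub_sub_cancel _ _

open Classical in
-- The holding time belongs to the request that starts it, so no shift to the next visit is needed;
-- its mean given the TTL is the truncated mean `sHat`.
theorem RequestModel.ae_tendsto_avg_holding (h : RequestModel μ P X c) (M : Catalog K T)
    (h0 : 0 ≤ θs) (hθs : θs ≤ θ) (k : Fin K) :
    ∀ᵐ ω ∂μ, Tendsto (avg fun l => if stateOf (c l ω) = Sum.inl k then
      holding M θ θs (fun i => X i ω) (fun i => c i ω) l else 0) atTop
      (𝓝 (stationary P (Sum.inl k) * (pCdf μ P X k (θ (M.typ k)) * sHat μ P X k (θ (M.typ k)) +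
        (1 - pCdf μ P X k (θ (M.typ k))) * sHat μ P X k (θs (M.typ k))))) := by
  set b := θ (M.typ k)
  have hs0 : 0 ≤ θs (M.typ k) := h0 _
  have hsb : θs (M.typ k) ≤ b := hθs _
  have hb0 : 0 ≤ b := hs0.trans hsb
  have hbound : ∀ a, 0 ≤ a → a ≤ b → ∀ y : ℝ, |max (min a y) 0| ≤ b := fun a ha hab y => by
    rw [abs_of_nonneg (le_max_right _ _)]
    exact max_le ((min_le_left _ _).trans hab) hb0
  filter_upwards [h.ae_nonneg, h.ae_tendsto_avg_recurring k b
    (v₁ := fun y => max (min b y) 0) (v₂ := fun y => max (min (θs (M.typ k)) y) 0)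
    (by fun_prop) (by fun_prop) (hbound b hb0 le_rfl) (hbound _ hs0 hsb)] with ω hx hω
  rw [h.integral_min k hb0, h.integral_min k hs0] at hω
  refine hω _ b (fun l => ?_) (fun l hl => if_neg hl) fun l m hz hn => ?_
  · split_ifs with hz
    · have ho : M.objType (c l ω) = M.typ k := by rw [stateOf_eq_inl_iff.1 hz]; rfl
      rw [abs_of_nonneg (holding_nonneg hx h0 hθs _ _)]
      exact (holding_le_ttl _ _).trans ((ttl_le hθs _ _).trans (by rw [ho]))
    · simpa using hb0
  · have ho : M.objType (c l ω) = M.typ k := by rw [stateOf_eq_inl_iff.1 hz]; rfl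
    have hw : 0 ≤ window (fun i => X i ω) l m := Finset.sum_nonneg fun i _ => hx _
    rw [if_pos hz, holding_of_isNext hn, arrival_sub_arrival, ttl, ho]
    split_ifs
    · rw [max_eq_left (le_min hb0 hw)]
    · rw [max_eq_left (le_min hs0 hw)]

end RecurringAverages

/-! ### Rare objects -/

section RareAverages

variable {K T : ℕ} {M : Catalog K T} {θ θs : Fin T → ℝ} {x : ℕ → ℝ} {c : ℕ → Obj K T} {R : ℝ}
  {t : Fin T}

theorem bursty_nonneg (l : ℕ) : 0 ≤ bursty x c t R l := by
  unfold bursty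
  split_ifs <;> simp

theorem bursty_eq_one_of_recent {l : ℕ} (hl : stateOf (c l) = Sum.inr t) {a : ℝ} (haR : a ≤ R)
    (h : Recent x c a l) : bursty x c t R l = 1 := by
  obtain ⟨l', h1, h2⟩ := h
  refine if_pos ⟨stateOf_eq_inr_iff.1 hl, ?_⟩
  refine (iInf₂_le l' ⟨h1.1, h1.2.1.symm⟩).trans_lt ?_
  exact_mod_cast h2.trans_le haR

/-- Sums over dyadically growing windows that are `o(m)` add up to `o(n)`. -/
theorem tendsto_avg_of_windows {y : ℕ → ℝ} (hy : ∀ l, 0 ≤ y l)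
    (h : Tendsto (fun m : ℕ => (1 / ((m + 1 : ℕ) : ℝ)) * ∑ l ∈ Finset.Icc m (m + (m + 1)), y l)
      atTop (𝓝 0)) : Tendsto (avg y) atTop (𝓝 0) := by
  have hmono : Monotone fun n => ∑ l ∈ Finset.range n, y l := fun a b hab =>
    Finset.sum_le_sum_of_subset_of_nonneg (Finset.range_mono hab) fun i _ _ => hy i
  rw [Metric.tendsto_atTop]
  intro ε hε
  obtain ⟨m₀, hm₀⟩ := (Metric.tendsto_atTop.1 h) (ε / 2) (half_pos hε)
  set C := ∑ l ∈ Finset.range (2 * m₀ + 2), y l with hC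
  have hS : ∀ n, ∑ l ∈ Finset.range n, y l ≤ C + ε / 2 * n := fun n => by
    induction n using Nat.strong_induction_on with
    | _ n ih =>
      rcases le_or_gt n (2 * m₀ + 2) with hn | hn
      · exact (hmono hn).trans (le_add_of_nonneg_right (by positivity))
      -- For this `m` one has `2m + 1 ≤ n ≤ 2m + 2`: the window from `m` to `2m + 1` covers the rest
      -- of the range, and its bound `(m + 1) ε / 2` fits with the inductive one for `m`.
      · set m := (n - 1) / 2
        have hm : m₀ ≤ m := by omega
        have hw := hm₀ m hm
        rw [Real.dist_eq, sub_zero, abs_of_nonneg (mul_nonneg (by positivity)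
          (Finset.sum_nonneg fun i _ => hy i)), one_div, inv_mul_lt_iff₀ (by positivity)] at hw
        have h1 : ∑ l ∈ Finset.range n, y l ≤
            ∑ l ∈ Finset.range m, y l + ∑ l ∈ Finset.Icc m (m + (m + 1)), y l := by
          rw [← Finset.Ico_add_one_right_eq_Icc, Finset.sum_range_add_sum_Ico _ (by omega)]
          exact hmono (by omega)
        have h2 := ih m (by omega)
        have h3 : ((m + 1 : ℕ) : ℝ) + m ≤ n := by
          have : m + 1 + m ≤ n := by omega
          exact_mod_cast this
        nlinarith
  obtain ⟨n₀, hn₀⟩ := exists_nat_gt (C / (ε / 2))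
  refine ⟨n₀ + 1, fun n hn => ?_⟩
  have hn1 : (n₀ : ℝ) + 1 ≤ n := by exact_mod_cast hn
  have hnpos : (0 : ℝ) < n := lt_of_lt_of_le (by positivity) hn1
  rw [Real.dist_eq, sub_zero, avg, abs_of_nonneg (div_nonneg (Finset.sum_nonneg fun i _ => hy i)
    hnpos.le), div_lt_iff₀ hnpos]
  rw [div_lt_iff₀ (half_pos hε)] at hn₀
  have := hS n
  nlinarith

/-- The windows `N m = m + 1` are `ω(√m)` and of length comparable to their starting point, so
halving repeatedly reaches the beginning of the sequence. -/
theorem RarityCondition.ae_tendsto_avg_bursty {Ω : Type*} [MeasurableSpace Ω] {μ : Measure Ω}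
    {X : ℕ → Ω → ℝ} {c : ℕ → Ω → Obj K T} (h : RarityCondition μ X c R) (t : Fin T) :
    ∀ᵐ ω ∂μ, Tendsto (avg (bursty (fun i => X i ω) (fun i => c i ω) t R)) atTop (𝓝 0) := by
  have ho : (fun m : ℕ => Real.sqrt (m : ℝ)) =o[atTop] fun m : ℕ => ((m + 1 : ℕ) : ℝ) := by
    have h1 : (fun m : ℕ => Real.sqrt (m : ℝ)) =o[atTop] fun m : ℕ => (m : ℝ) := by
      have h2 : (fun _ : ℕ => (1 : ℝ)) =o[atTop] fun m : ℕ => Real.sqrt (m : ℝ) :=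
        (isLittleO_one_left_iff ℝ).2 (tendsto_norm_atTop_atTop.comp
          (Real.tendsto_sqrt_atTop.comp tendsto_natCast_atTop_atTop))
      exact (h2.mul_isBigO (isBigO_refl (fun m : ℕ => Real.sqrt (m : ℝ)) atTop)).congr
        (fun m => one_mul _) fun m => Real.mul_self_sqrt (Nat.cast_nonneg m)
    refine h1.trans_isBigO (IsBigO.of_bound 1 (.of_forall fun m => ?_))
    rw [one_mul, Real.norm_natCast, Real.norm_natCast]
    exact_mod_cast Nat.le_succ m
  filter_upwards [h t (fun m => m + 1) ho] with ω hω
  exact tendsto_avg_of_windows (fun l => bursty_nonneg l) hω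

open Classical in
/-- Requests for rare objects are hits only if they are bursty. -/
theorem tendsto_avg_rare_hit (hx : ∀ l, 0 ≤ x l) (hθs : θs ≤ θ) (hR : θ t ≤ R)
    (hb : Tendsto (avg (bursty x c t R)) atTop (𝓝 0)) :
    Tendsto (avg fun l => if stateOf (c l) = Sum.inr t then
      if fHit M θ θs x c l then 1 else 0 else 0) atTop (𝓝 0) := by
  refine squeeze_zero (fun n => ?_) (fun n => avg_mono (fun l => ?_) n) hb
  · unfold avg
    positivity
  · split_ifs with h1 h2
    · obtain ⟨l', h3, h4⟩ := (fHit_iff hx hθs).1 h2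
      refine (bursty_eq_one_of_recent h1 hR ⟨l', h3, h4.trans_le ?_⟩).ge
      obtain ⟨n, hn⟩ := stateOf_eq_inr_iff.1 h1
      have ho : M.objType (c l') = t := by rw [← h3.2.1, hn]; rfl
      exact (ttl_le hθs c l').trans (by rw [ho])
    · exact bursty_nonneg l
    · exact bursty_nonneg l

open Classical in
/-- Few requests for rare objects are soon followed by another one for the same object. -/
theorem tendsto_avg_rare_next (hx : ∀ l, 0 ≤ x l) {m : ℝ} (hm : 0 < m)
    (harr : Tendsto (fun n : ℕ => arrival x n / n) atTop (𝓝 m)) {a : ℝ} (hR : a ≤ R)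
    (hb : Tendsto (avg (bursty x c t R)) atTop (𝓝 0)) :
    Tendsto (avg fun l => if stateOf (c l) = Sum.inr t ∧
      ∃ j, IsNext c l j ∧ arrival x (j + 1) - arrival x (l + 1) < a then 1 else 0)
      atTop (𝓝 0) := by
  have hdouble : Tendsto (fun n : ℕ => 2 * n) atTop atTop :=
    tendsto_id.const_mul_atTop' two_pos
  have hb2 := (hb.comp hdouble).const_mul 2
  rw [mul_zero] at hb2
  -- As arrivals grow linearly, more than time `a` eventually passes between requests `n` and `2n`,
  -- so a next request within time `a` of one before `n` comes before `2n`.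
  have hgap : Tendsto (fun n : ℕ => arrival x (2 * n) - arrival x n) atTop atTop := by
    have e1 : Tendsto (fun n : ℕ => 2 * (arrival x (2 * n) / (2 * n : ℕ)) - arrival x n / n) atTop
        (𝓝 m) := by
      have := ((harr.comp hdouble).const_mul 2).sub harr
      rwa [show 2 * m - m = m by ring] at this
    refine (e1.pos_mul_atTop hm tendsto_natCast_atTop_atTop).congr' ?_
    filter_upwards [eventually_gt_atTop 0] with n hn
    have : (n : ℝ) ≠ 0 := by positivity
    push_cast
    field_simp
  refine squeeze_zero' (.of_forall fun n => by unfold avg; positivity) ?_ hb2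
  filter_upwards [hgap.eventually_ge_atTop a, eventually_gt_atTop 0] with n hn hn0
  -- Sending a request to its next one is injective and lands on bursty requests below `2n`. The
  -- default value `0` is never taken on the filtered set.
  have hcard : ((Finset.range n).filter fun l => stateOf (c l) = Sum.inr t ∧
      ∃ j, IsNext c l j ∧ arrival x (j + 1) - arrival x (l + 1) < a).card ≤
      ((Finset.range (2 * n)).filter fun j => bursty x c t R j = 1).card := by
    refine Finset.card_le_card_of_injOn (fun l => if h : ∃ j, IsNext c l j then h.choose else 0)
      (fun l hl => ?_) (fun l hl l' hl' he => ?_)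
    · simp only [Finset.coe_filter, Finset.mem_range, Set.mem_ofPred_eq] at hl ⊢
      obtain ⟨hl1, hl2, j, hj, hja⟩ := hl
      have hex : ∃ j, IsNext c l j := ⟨j, hj⟩
      rw [dif_pos hex, hex.choose_spec.right_unique hj]
      refine ⟨?_, bursty_eq_one_of_recent (by rw [hj.2.1, hl2]) hR ⟨l, hj, hja⟩⟩
      by_contra hlt
      have h1 := monotone_arrival hx (show 2 * n ≤ j + 1 by omega)
      have h2 := monotone_arrival hx (show l + 1 ≤ n by omega)
      linarith
    · simp only [Finset.coe_filter, Finset.mem_range, Set.mem_ofPred_eq] at hl hl'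
      obtain ⟨-, -, j, hj, -⟩ := hl
      obtain ⟨-, -, j', hj', -⟩ := hl'
      have hex : ∃ j, IsNext c l j := ⟨j, hj⟩
      have hex' : ∃ j, IsNext c l' j := ⟨j', hj'⟩
      simp only [dif_pos hex, dif_pos hex'] at he
      exact hex.choose_spec.left_unique (he ▸ hex'.choose_spec)
  have hsum : ((((Finset.range (2 * n)).filter fun j => bursty x c t R j = 1).card : ℕ) : ℝ) ≤
      ∑ j ∈ Finset.range (2 * n), bursty x c t R j := by
    rw [← Finset.sum_boole]
    refine Finset.sum_le_sum fun j _ => ?_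
    split_ifs with h
    · exact h.ge
    · exact bursty_nonneg j
  have hn' : (0 : ℝ) < n := by exact_mod_cast hn0
  rw [Function.comp, avg, avg, Finset.sum_boole]
  push_cast
  rw [← mul_div_assoc, mul_div_mul_left _ _ two_ne_zero]
  gcongr
  exact le_trans (by exact_mod_cast hcard) hsum

open Classical in
/-- Most requests for rare objects put the object into the shallow cache for the full TTL. -/
theorem tendsto_avg_rare_holding (hx : ∀ l, 0 ≤ x l) {m : ℝ} (hm : 0 < m)
    (harr : Tendsto (fun n : ℕ => arrival x n / n) atTop (𝓝 m)) (h0 : 0 ≤ θs) (hθs : θs ≤ θ)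
    (hR : θ t ≤ R) (hb : Tendsto (avg (bursty x c t R)) atTop (𝓝 0)) {p : ℝ}
    (hocc : Tendsto (avg fun l => if stateOf (c l) = Sum.inr t then 1 else 0) atTop (𝓝 p)) :
    Tendsto (avg fun l => if stateOf (c l) = Sum.inr t then holding M θ θs x c l else 0) atTop
      (𝓝 (p * θs t)) := by
  have hθ0 : 0 ≤ θ t := (h0 t).trans (hθs t)
  have hnext := tendsto_avg_rare_next (c := c) hx hm harr ((hθs t).trans hR) hb
  -- The holding time differs from `θs t` only if the request is itself bursty, and then may get the
  -- deep TTL, or is followed too soon by another; the error is at most `θ t`.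
  have herr : Tendsto (fun n => avg (fun l => if stateOf (c l) = Sum.inr t then
      holding M θ θs x c l - θs t else 0) n) atTop (𝓝 0) := by
    have hsq := (hb.add hnext).const_mul (θ t)
    rw [add_zero, mul_zero] at hsq
    refine squeeze_zero_norm (fun n => ?_) hsq
    rw [← avg_add, ← avg_const_mul, Real.norm_eq_abs, avg, avg, abs_div,
      abs_of_nonneg (Nat.cast_nonneg n : (0 : ℝ) ≤ n)]
    gcongr
    refine (Finset.abs_sum_le_sum_abs _ _).trans (Finset.sum_le_sum fun l _ => ?_)
    have hbn := bursty_nonneg (x := x) (c := c) (t := t) (R := R) l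
    by_cases hz : stateOf (c l) = Sum.inr t
    · obtain ⟨n, hn⟩ := stateOf_eq_inr_iff.1 hz
      have ho : M.objType (c l) = t := by rw [hn]; rfl
      have hd0 := holding_nonneg (M := M) hx h0 hθs c l
      have hd1 : holding M θ θs x c l ≤ θ t :=
        ho ▸ (holding_le_ttl c l).trans (ttl_le hθs c l)
      have habs : |holding M θ θs x c l - θs t| ≤ θ t := by
        rw [abs_le]
        have := h0 t
        have := hθs t
        rw [Pi.zero_apply] at *
        constructor <;> linarith
      rw [if_pos hz]
      by_cases hr : Recent x c (θ t) l
      · rw [bursty_eq_one_of_recent hz hR hr]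
        refine habs.trans (le_mul_of_one_le_right hθ0 ?_)
        split_ifs <;> norm_num
      · by_cases hj : ∃ j, IsNext c l j ∧ arrival x (j + 1) - arrival x (l + 1) < θs t
        · rw [if_pos ⟨hz, hj⟩]
          exact habs.trans (le_mul_of_one_le_right hθ0 (by linarith))
        · have httl : ttl M θ θs x c l = θs t := by rw [ttl, ho, if_neg hr]
          have : holding M θ θs x c l = θs t := by
            rcases exists_isNext_right c l with h | ⟨j, h⟩
            · rw [holding_of_last h, httl]
            · push Not at hj
              rw [holding_of_isNext h, httl, min_eq_left (hj j h)]
          rw [this, sub_self, abs_zero]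
          positivity
    · rw [if_neg hz, abs_zero]
      positivity
  have := herr.add (hocc.mul_const (θs t))
  rw [zero_add] at this
  refine this.congr fun n => ?_
  rw [← avg_mul_const, ← avg_add]
  congr 1
  funext l
  split_ifs <;> simp

end RareAverages

/-! ### Performance and feasible sets -/

section Main

variable {K T : ℕ} {M : Catalog K T} {θ θs L : Fin T → ℝ} {Ω : Type*} [MeasurableSpace Ω]
  {μ : Measure Ω} [IsProbabilityMeasure μ] {P : Matrix (State K T) (State K T) ℝ}
  {X : ℕ → Ω → ℝ} {c : ℕ → Ω → Obj K T}

/-- The average over the requests of one type, from the averages over the states. -/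
theorem tendsto_avg_type {c : ℕ → Obj K T} {t : Fin T} {w : Obj K T → ℝ}
    (hw : ∀ n, w (Sum.inr (t, n)) = w (Sum.inr (t, 0))) {y : ℕ → ℝ} {a : Fin K → ℝ} {r : ℝ}
    (hk : ∀ k, M.typ k = t → Tendsto (avg fun l => if stateOf (c l) = Sum.inl k then y l else 0)
      atTop (𝓝 (a k)))
    (hr : Tendsto (avg fun l => if stateOf (c l) = Sum.inr t then y l else 0) atTop (𝓝 r)) :
    Tendsto (avg fun l => if M.objType (c l) = t then w (c l) * y l else 0) atTop
      (𝓝 (∑ k with M.typ k = t, w (Sum.inl k) * a k + w (Sum.inr (t, 0)) * r)) := by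
  have h := (tendsto_finsetSum (Finset.univ.filter fun k => M.typ k = t) fun k hkt =>
    (hk k (Finset.mem_filter.1 hkt).2).const_mul (w (Sum.inl k))).add
    (hr.const_mul (w (Sum.inr (t, 0))))
  refine h.congr fun n => ?_
  simp only [← avg_const_mul]
  rw [← avg_sum, ← avg_add]
  congr 1
  funext l
  rcases hc : c l with k | ⟨s, n⟩
  · simp only [stateOf, Catalog.objType, Sum.map_inl, Sum.elim_inl, id, Sum.inl.injEq, mul_ite,
      mul_zero, Finset.sum_ite_eq, Finset.mem_filter, Finset.mem_univ, true_and, reduceCtorEq,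
      if_false, add_zero]
    by_cases hkt : M.typ k = t <;> simp [hkt]
  · by_cases hs : s = t
    · subst hs
      simp [stateOf, Catalog.objType, hw n]
    · simp [stateOf, Catalog.objType, hs]

theorem hitWeight_inr (κ : HitKind) (t : Fin T) (n : ℕ) :
    hitWeight M κ (Sum.inr (t, n)) = hitWeight M κ (Sum.inr (t, 0)) := by
  cases κ <;> rfl

theorem objSize_pos (M : Catalog K T) (o : Obj K T) : 0 < M.objSize o := by
  rcases o with k | r
  · exact M.size_pos k
  · exact M.rareSize_pos r.1

theorem hitWeight_pos (M : Catalog K T) (κ : HitKind) (o : Obj K T) : 0 < hitWeight M κ o := by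
  cases κ
  · exact one_pos
  · exact objSize_pos M o

/-- The rare term alone is positive, so the limiting denominator does not vanish even for a type
without recurring objects. -/
theorem sum_weight_pos {π : State K T → ℝ} (hπ : ∀ s, 0 < π s) {w : Obj K T → ℝ}
    (hw : ∀ o, 0 < w o) (t : Fin T) : 0 < ∑ k with M.typ k = t, w (Sum.inl k) * π (Sum.inl k) +
      w (Sum.inr (t, 0)) * π (Sum.inr t) :=
  add_pos_of_nonneg_of_pos (Finset.sum_nonneg fun _ _ => (mul_pos (hw _) (hπ _)).le)
    (mul_pos (hw _) (hπ _))

/-- The performance of f-TTL with fixed TTL values. -/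
theorem RequestModel.ae_fTTL_performance (h : RequestModel μ P X c)
    (hrare : RarityCondition μ X c ‖L‖) (M : Catalog K T) (hL : θ ≤ L) (h0 : 0 ≤ θs)
    (hθs : θs ≤ θ) (κ : HitKind) :
    ∀ᵐ ω ∂μ, ∀ t,
      hitRate M (fun l => X l ω) (fun l => c l ω) κ
        (fHit M θ θs (fun l => X l ω) (fun l => c l ω)) t =
          (hitFun M μ P X κ θ θs t : EReal) ∧
      normalizedSize M (fun l => X l ω) (fun l => c l ω)
        (fCache M θ θs (fun l => X l ω) (fun l => c l ω)) t =
          (sizeFun M μ P X θ θs t : EReal) := by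
  obtain ⟨hst, hocc⟩ := h.markovInput.ae_tendsto_occupation h.irreducible
  have hπ := hst.pos h.irreducible
  have hm := h.mean_pos
  have hrate : rate μ X ≠ 0 := by
    unfold rate
    positivity
  filter_upwards [h.ae_nonneg, h.ae_tendsto_arrival, hocc,
    ae_all_iff.2 fun k => h.ae_tendsto_avg_hit M hθs k,
    ae_all_iff.2 fun k => h.ae_tendsto_avg_holding M h0 hθs k,
    ae_all_iff.2 fun t => hrare.ae_tendsto_avg_bursty t] with ω hx harr hocc hhit hhold hb t
  have hlim := tendsto_arrival_atTop hm harr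
  have hR : θ t ≤ ‖L‖ := (hL t).trans ((le_abs_self _).trans (norm_le_pi_norm L t))
  have hweight : ∀ w : Obj K T → ℝ, (∀ n, w (Sum.inr (t, n)) = w (Sum.inr (t, 0))) →
      Tendsto (avg fun l => if M.objType (c l ω) = t then w (c l ω) * 1 else 0) atTop
        (𝓝 (∑ k with M.typ k = t, w (Sum.inl k) * stationary P (Sum.inl k) +
          w (Sum.inr (t, 0)) * stationary P (Sum.inr t))) := fun w hw =>
    tendsto_avg_type hw (fun k _ => hocc (Sum.inl k)) (hocc (Sum.inr t))
  constructor
  · have hY := tendsto_avg_type (M := M) (w := hitWeight M κ) (hitWeight_inr κ t)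
      (fun k _ => hhit k) (tendsto_avg_rare_hit (M := M) hx hθs hR (hb t))
    -- The averages are per request and involve `π`; expanding the fraction by the overall rate
    -- turns these frequencies into the request rates of `hitFun`.
    rw [hitRate_eq hx hlim (sum_weight_pos hπ (hitWeight_pos M κ) t).ne' hY
      (hweight _ (hitWeight_inr κ t)), hitFun, ← mul_div_mul_right _ _ hrate]
    congr 2
    · rw [mul_zero, add_zero, Finset.sum_mul]
      refine Finset.sum_congr rfl fun k hk => ?_
      rw [(Finset.mem_filter.1 hk).2, objRate]
      ring
    · rw [add_mul, Finset.sum_mul, add_comm]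
      congr 1
      · rw [rareRate]
        ring
      · refine Finset.sum_congr rfl fun k hk => ?_
        rw [objRate]
        ring
  · have hY := tendsto_avg_type (M := M) (w := M.objSize) (fun _ => rfl)
      (fun k _ => hhold k)
      (tendsto_avg_rare_holding (M := M) hx hm harr h0 hθs hR (hb t) (hocc (Sum.inr t)))
    rw [normalizedSize_fCache_eq hx hm harr h0 hθs (sum_weight_pos hπ (objSize_pos M) t).ne' hY
      (hweight _ fun _ => rfl), sizeFun, ← mul_div_mul_right _ _ hrate]
    congr 2
    · rw [add_mul, Finset.sum_mul]
      congr 1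
      · refine Finset.sum_congr rfl fun k hk => ?_
        rw [(Finset.mem_filter.1 hk).2, objRate]
        simp only [Catalog.objSize, Sum.elim_inl]
        ring
      · rw [rareRate]
        simp only [Catalog.objSize, Sum.elim_inr]
        ring
    · rw [add_mul, Finset.sum_mul, add_comm]
      congr 1
      · rw [rareRate]
        simp only [Catalog.objSize, Sum.elim_inr]
        ring
      · refine Finset.sum_congr rfl fun k hk => ?_
        rw [objRate]
        simp only [Catalog.objSize, Sum.elim_inl]
        ring

theorem RequestModel.dFeasible_iff (h : RequestModel μ P X c)
    (hrare : RarityCondition μ X c ‖L‖) (M : Catalog K T) (κ : HitKind) (r : Fin T → ℝ) :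
    DFeasible M μ X c L κ r ↔
      ∃ θ : Fin T → ℝ, 0 ≤ θ ∧ θ ≤ L ∧ r = hitFun M μ P X κ θ θ := by
  refine exists_congr fun θ => and_congr_right fun h0 => and_congr_right fun hL => ?_
  have hd : ∀ ω, dHit M θ (fun l => X l ω) (fun l => c l ω) =
      fHit M θ θ (fun l => X l ω) (fun l => c l ω) := fun ω =>
    funext fun l => propext (dHit_iff_fHit h0 _ l)
  have hperf := h.ae_fTTL_performance hrare M hL h0 le_rfl κ
  simp only [hd]
  constructor
  · intro hr
    -- Two almost sure statements hold together at some sample point, and there both describe the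
    -- same hit rate.
    obtain ⟨ω, h1, h2⟩ := (hr.and hperf).exists
    exact funext fun t => EReal.coe_injective ((h1 t).symm.trans (h2 t).1)
  · rintro rfl
    filter_upwards [hperf] with ω hω t
    exact (hω t).1

theorem RequestModel.fFeasible_iff (h : RequestModel μ P X c)
    (hrare : RarityCondition μ X c ‖L‖) (M : Catalog K T) (κ : HitKind) (r s : Fin T → ℝ) :
    FFeasible M μ X c L κ r s ↔ ∃ θ θs : Fin T → ℝ, θ ≤ L ∧ 0 ≤ θs ∧ θs ≤ θ ∧
      (r, s) = (hitFun M μ P X κ θ θs, sizeFun M μ P X θ θs) := by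
  refine exists_congr fun θ => exists_congr fun θs => and_congr_right fun hL =>
    and_congr_right fun h0 => and_congr_right fun hθs => ?_
  have hperf := h.ae_fTTL_performance hrare M hL h0 hθs κ
  rw [Prod.mk.injEq]
  constructor
  · intro hr
    obtain ⟨ω, h1, h2⟩ := (hr.and hperf).exists
    exact ⟨funext fun t => EReal.coe_injective ((h1 t).1.symm.trans (h2 t).1),
      funext fun t => EReal.coe_injective ((h1 t).2.symm.trans (h2 t).2)⟩
  · rintro ⟨rfl, rfl⟩
    exact hperf

end Main

end TTLCache

end

theorem mainTheorem7 {K T : ℕ} {Ω : Type*} [MeasurableSpace Ω] (μ : Measure Ω)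
    [IsProbabilityMeasure μ] (M : TTLCache.Catalog K T)
    (P : Matrix (TTLCache.State K T) (TTLCache.State K T) ℝ)
    (X : ℕ → Ω → ℝ) (c : ℕ → Ω → TTLCache.Obj K T) (L : Fin T → ℝ)
    (hmodel : TTLCache.RequestModel μ P X c)
    (hrare : TTLCache.RarityCondition μ X c ‖L‖)
    (κ : TTLCache.HitKind) :
    {h : Fin T → ℝ | TTLCache.DFeasible M μ X c L κ h} =
      {h : Fin T → ℝ | ∃ θ : Fin T → ℝ, 0 ≤ θ ∧ θ ≤ L ∧
        h = TTLCache.hitFun M μ P X κ θ θ} ∧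
    {q : (Fin T → ℝ) × (Fin T → ℝ) | TTLCache.FFeasible M μ X c L κ q.1 q.2} =
      {q : (Fin T → ℝ) × (Fin T → ℝ) | ∃ θ θs : Fin T → ℝ, θ ≤ L ∧ 0 ≤ θs ∧ θs ≤ θ ∧
        q = (TTLCache.hitFun M μ P X κ θ θs, TTLCache.sizeFun M μ P X θ θs)} := by
  exact ⟨Set.ext fun r => hmodel.dFeasible_iff hrare M κ r,
    Set.ext fun q => hmodel.fFeasible_iff hrare M κ q.1 q.2⟩
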